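/- Let $1<c<4/3$ and let $\phi_0$ be the profile of a smooth solitary wave $u(x,t)=\phi_0(x-ct)$ with zero background of the Fornberg–Whitham equation $u_t-u_{txx}+u_x+uu_x=uu_{xxx}+3u_xu_{xx}$; that is, $\phi_0\in C^\infty(\mathbb{R})$ is real-valued and not identically zero, satisfies $$-c\,\phi_0'+c\,\phi_0'''+\phi_0'+\phi_0\phi_0'=\phi_0\phi_0'''+3\phi_0'\phi_0''\quad\text{on }\mathbb{R},$$ $\phi_0(x)\to0$ as $|x|\to\infty$, and $\phi_0'(0)=0$. Let $(1-\partial_x^2)^{-1}v=G*v$ with $G(x)=\tfrac12e^{-|x|}$, and let $$\mathcal{L}=(c-\phi_0)-(1-\partial_x^2)^{-1}$$ on the complex Hilbert space $L^2(\mathbb{R})$. Put $\lambda_0=c-1-\phi_{\max}$, where $\phi_{\max}=2c-\tfrac43-\tfrac23\sqrt{4-3c}$ (the maximum of $\phi_0$). Then $\mathcal{L}$ is a bounded self-adjoint operator and its spectrum is real. The function $\phi_0'$ belongs to $L^2(\mathbb{R})$, and the kernel of $\mathcal{L}$ is one-dimensional and spanned by $\phi_0'$. Moreover, $\mathcal{L}$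 has exactly one negative eigenvalue; it is simple and lies in $(\lambda_0,0)$. -/

import Mathlib

open MeasureTheory Filter Topology
open scoped ENNReal ContDiff

noncomputable section

/-- The complex Hilbert space `L²(ℝ)`. -/
abbrev L2 : Type := Lp ℂ 2 (volume : Measure ℝ)

/-! ### Smooth solitary waves of the Fornberg-Whitham equation -/

/-- `φ` is the profile of a smooth solitary wave `u(x,t) = φ(x - ct)` with zero background of
`u_t - u_txx + u_x + u u_x = u u_xxx + 3 u_x u_xx`, normalised by `φ'(0) = 0`. -/
structure IsSolitaryWave (c : ℝ) (φ : ℝ → ℝ) : Prop where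
  smooth : ContDiff ℝ ∞ φ
  travelling_wave : ∀ x, -c * deriv φ x + c * iteratedDeriv 3 φ x + deriv φ x + φ x * deriv φ x
    = φ x * iteratedDeriv 3 φ x + 3 * deriv φ x * iteratedDeriv 2 φ x
  tendsto_atTop : Tendsto φ atTop (𝓝 0)
  tendsto_atBot : Tendsto φ atBot (𝓝 0)
  deriv_zero : deriv φ 0 = 0
  nontrivial : ∃ x, φ x ≠ 0

/-- The crest height `2c - 4/3 - (2/3)√(4 - 3c)` of the solitary wave of speed `c`. -/
def phiMax (c : ℝ) : ℝ := 2 * c - 4 / 3 - 2 * Real.sqrt (4 - 3 * c) / 3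

/-- The number `λ₀ = c - 1 - φ_max`. -/
def lambdaZero (c : ℝ) : ℝ := c - 1 - phiMax c

theorem IsSolitaryWave.memLp_top_symbol {c : ℝ} {φ : ℝ → ℝ} (hφ : IsSolitaryWave c φ) :
    MemLp (fun x => ((c - φ x : ℝ) : ℂ)) ∞ volume := by
  have hcont : Continuous φ := hφ.smooth.continuous
  have hlim : Tendsto φ (cocompact ℝ) (𝓝 0) := by
    rw [cocompact_eq_atBot_atTop]
    exact hφ.tendsto_atBot.sup hφ.tendsto_atTop
  let f : ZeroAtInftyContinuousMap ℝ ℝ := ⟨⟨φ, hcont⟩, hlim⟩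
  refine memLp_top_of_bound (by fun_prop) (|c| + ‖f.toBCF‖) (.of_forall fun x => ?_)
  rw [Complex.norm_real]
  exact (norm_sub_le _ _).trans (add_le_add le_rfl (f.toBCF.norm_coe_le_norm x))

/-! ### The inverse Helmholtz operator `(1 - ∂ₓ²)⁻¹` on `L²(ℝ)` -/

/-- The Green function `G(x) = e^{-|x|} / 2` of `1 - ∂ₓ²`. -/
def greenFun (x : ℝ) : ℝ := Real.exp (-|x|) / 2

/-- The convolution `(G ∗ v)(x) = ∫ G(x - y) v(y) dy`. -/
def greenConv (v : ℝ → ℂ) (x : ℝ) : ℂ := ∫ y, (greenFun (x - y) : ℂ) * v y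

theorem continuous_greenFun : Continuous greenFun := by
  unfold greenFun; fun_prop

theorem greenFun_nonneg (x : ℝ) : 0 ≤ greenFun x := by
  unfold greenFun; positivity

theorem integral_greenFun : ∫ x, greenFun x = 1 := by
  have h : ∫ x : ℝ, Real.exp (-|x|) = 2 := by
    rw [integral_comp_abs (f := fun x => Real.exp (-x)), integral_exp_neg_Ioi_zero]
    norm_num
  simp only [greenFun]
  rw [integral_div, h]
  norm_num

theorem integrable_greenFun : Integrable greenFun :=
  Integrable.of_integral_ne_zero (by rw [integral_greenFun]; norm_num)

theorem lintegral_greenFun : ∫⁻ x, ENNReal.ofReal (greenFun x) = 1 := by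
  rw [← ofReal_integral_eq_lintegral_ofReal integrable_greenFun (.of_forall greenFun_nonneg),
    integral_greenFun, ENNReal.ofReal_one]

theorem memLp_greenFun (x : ℝ) : MemLp (fun y => (greenFun (x - y) : ℂ)) 2 volume := by
  have hc := continuous_greenFun
  have hm : AEStronglyMeasurable (fun y => (greenFun (x - y) : ℂ)) volume :=
    Continuous.aestronglyMeasurable (by fun_prop)
  rw [memLp_two_iff_integrable_sq_norm hm]
  refine (integrable_greenFun.comp_sub_left x).mono'
    (Continuous.aestronglyMeasurable (by fun_prop)) (.of_forall fun y => ?_)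
  have h1 : greenFun (x - y) ≤ 1 := by
    have : Real.exp (-|x - y|) ≤ 1 := Real.exp_le_one_iff.2 (by simp)
    unfold greenFun
    linarith
  rw [Complex.norm_real, Real.norm_of_nonneg (by positivity),
    Real.norm_of_nonneg (greenFun_nonneg _)]
  nlinarith [greenFun_nonneg (x - y)]

theorem integrable_greenConv {v : ℝ → ℂ} (hv : MemLp v 2 volume) (x : ℝ) :
    Integrable (fun y => (greenFun (x - y) : ℂ) * v y) :=
  (memLp_greenFun x).integrable_mul hv

theorem enorm_greenConv_sq_le {v : ℝ → ℂ} (hv : MemLp v 2 volume) (x : ℝ) :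
    ‖greenConv v x‖ₑ ^ (2 : ℝ) ≤ ∫⁻ y, ENNReal.ofReal (greenFun (x - y)) * ‖v y‖ₑ ^ (2 : ℝ) := by
  have hc := continuous_greenFun
  have hg : Measurable fun y => ENNReal.ofReal (greenFun (x - y)) :=
    ENNReal.measurable_ofReal.comp (Continuous.measurable (by fun_prop))
  have hv1 : AEMeasurable (fun y => ‖v y‖ₑ) volume := hv.1.enorm
  have key := ENNReal.lintegral_mul_le_Lp_mul_Lq volume Real.HolderConjugate.two_two
    (f := fun y => ENNReal.ofReal (greenFun (x - y)) ^ (1 / 2 : ℝ))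
    (g := fun y => ENNReal.ofReal (greenFun (x - y)) ^ (1 / 2 : ℝ) * ‖v y‖ₑ)
    (hg.pow_const _).aemeasurable ((hg.pow_const _).aemeasurable.mul hv1)
  have hsq : ∀ a : ℝ≥0∞, (a ^ (1 / 2 : ℝ)) ^ (2 : ℝ) = a := fun a => by
    rw [← ENNReal.rpow_mul]; norm_num
  have hsq' : ∀ a : ℝ≥0∞, a ^ (1 / 2 : ℝ) * a ^ (1 / 2 : ℝ) = a := fun a => by
    rw [← ENNReal.rpow_add_of_nonneg _ _ (by norm_num) (by norm_num)]; norm_num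
  simp only [Pi.mul_apply, ENNReal.mul_rpow_of_nonneg _ _ (zero_le_two : (0 : ℝ) ≤ 2), hsq,
    ← mul_assoc, hsq'] at key
  rw [lintegral_sub_left_eq_self (fun y => ENNReal.ofReal (greenFun y)) x, lintegral_greenFun,
    ENNReal.one_rpow, one_mul] at key
  have h1 : ‖greenConv v x‖ₑ ≤ ∫⁻ y, ENNReal.ofReal (greenFun (x - y)) * ‖v y‖ₑ := by
    refine (enorm_integral_le_lintegral_enorm _).trans_eq (lintegral_congr fun y => ?_)
    rw [enorm_mul, ← ofReal_norm (greenFun (x - y) : ℂ), Complex.norm_real,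
      Real.norm_of_nonneg (greenFun_nonneg _)]
  refine (ENNReal.rpow_le_rpow (h1.trans key) zero_le_two).trans_eq ?_
  rw [hsq]

theorem aestronglyMeasurable_greenConv {v : ℝ → ℂ} (hv : AEStronglyMeasurable v volume) :
    AEStronglyMeasurable (greenConv v) volume := by
  have hc := continuous_greenFun
  refine AEStronglyMeasurable.integral_prod_right'
    (f := fun z : ℝ × ℝ => (greenFun (z.1 - z.2) : ℂ) * v z.2) ?_
  exact (Continuous.aestronglyMeasurable (by fun_prop)).mul hv.comp_snd

theorem eLpNorm_greenConv_le {v : ℝ → ℂ} (hv : MemLp v 2 volume) :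
    eLpNorm (greenConv v) 2 volume ≤ eLpNorm v 2 volume := by
  have hc := continuous_greenFun
  have h : ∫⁻ x, ‖greenConv v x‖ₑ ^ (2 : ℝ) ≤ ∫⁻ y, ‖v y‖ₑ ^ (2 : ℝ) := by
    refine (lintegral_mono fun x => enorm_greenConv_sq_le hv x).trans_eq ?_
    rw [lintegral_lintegral_swap]
    · refine lintegral_congr fun y => ?_
      have hg : Measurable fun x => ENNReal.ofReal (greenFun (x - y)) :=
        ENNReal.measurable_ofReal.comp (Continuous.measurable (by fun_prop))
      rw [lintegral_mul_const _ hg,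
        lintegral_sub_right_eq_self (fun x => ENNReal.ofReal (greenFun x)) y,
        lintegral_greenFun, one_mul]
    · have hg : Measurable fun z : ℝ × ℝ => ENNReal.ofReal (greenFun (z.1 - z.2)) :=
        ENNReal.measurable_ofReal.comp (Continuous.measurable (by fun_prop))
      exact hg.aemeasurable.mul (hv.1.comp_snd.enorm.pow_const _)
  rw [eLpNorm_eq_lintegral_rpow_enorm_toReal two_ne_zero ENNReal.ofNat_ne_top,
    eLpNorm_eq_lintegral_rpow_enorm_toReal two_ne_zero ENNReal.ofNat_ne_top]
  exact ENNReal.rpow_le_rpow (by simpa using h) (by norm_num)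

theorem memLp_greenConv {v : ℝ → ℂ} (hv : MemLp v 2 volume) :
    MemLp (greenConv v) 2 volume :=
  ⟨aestronglyMeasurable_greenConv hv.1, (eLpNorm_greenConv_le hv).trans_lt hv.2⟩

theorem greenConv_congr {v w : ℝ → ℂ} (h : v =ᵐ[volume] w) : greenConv v = greenConv w := by
  funext x
  exact integral_congr_ae (h.mono fun y hy => by simp only [hy])

/-- The operator `(1 - ∂ₓ²)⁻¹ v = G ∗ v` on `L²(ℝ)`. -/
def helmholtzInv : L2 →L[ℂ] L2 :=
  LinearMap.mkContinuous
    { toFun := fun v => (memLp_greenConv (Lp.memLp v)).toLp (greenConv v)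
      map_add' := fun v w => by
        rw [← MemLp.toLp_add]
        refine MemLp.toLp_congr _ _ (.of_forall fun x => ?_)
        rw [greenConv_congr (Lp.coeFn_add v w), Pi.add_apply]
        simp only [greenConv, Pi.add_apply, mul_add]
        exact integral_add (integrable_greenConv (Lp.memLp v) x)
          (integrable_greenConv (Lp.memLp w) x)
      map_smul' := fun a v => by
        rw [RingHom.id_apply, ← MemLp.toLp_const_smul]
        refine MemLp.toLp_congr _ _ (.of_forall fun x => ?_)
        rw [greenConv_congr (Lp.coeFn_smul a v), Pi.smul_apply]
        simp only [greenConv, Pi.smul_apply, smul_eq_mul, mul_left_comm _ a]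
        exact integral_const_mul _ _ }
    1 (fun v => by
      rw [one_mul, Lp.norm_def v]
      simp only [LinearMap.coe_mk, AddHom.coe_mk, Lp.norm_toLp]
      exact ENNReal.toReal_mono (Lp.eLpNorm_ne_top v) (eLpNorm_greenConv_le (Lp.memLp v)))

theorem coeFn_helmholtzInv (v : L2) : helmholtzInv v =ᵐ[volume] greenConv v :=
  (memLp_greenConv (Lp.memLp v)).coeFn_toLp

/-! ### The linearised operator -/

/-- Multiplication by an essentially bounded function on `L²(ℝ)`. -/
def mulOp {m : ℝ → ℂ} (hm : MemLp m ∞ volume) : L2 →L[ℂ] L2 :=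
  (ContinuousLinearMap.mul ℂ ℂ).holderL volume ∞ 2 2 (hm.toLp m)

theorem coeFn_mulOp {m : ℝ → ℂ} (hm : MemLp m ∞ volume) (v : L2) :
    mulOp hm v =ᵐ[volume] fun x => m x * v x := by
  filter_upwards [(ContinuousLinearMap.mul ℂ ℂ).coeFn_holder (r := 2) (hm.toLp m) v,
    hm.coeFn_toLp] with x hx hx'
  simp only [mulOp, ContinuousLinearMap.holderL_apply_apply]
  rw [hx, hx', ContinuousLinearMap.mul_apply']

/-- The operator `L = (c - φ) - (1 - ∂ₓ²)⁻¹` on `L²(ℝ)`. -/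
def linearizedOp {c : ℝ} {φ : ℝ → ℝ} (hφ : IsSolitaryWave c φ) : L2 →L[ℂ] L2 :=
  mulOp hφ.memLp_top_symbol - helmholtzInv

theorem coeFn_linearizedOp {c : ℝ} {φ : ℝ → ℝ} (hφ : IsSolitaryWave c φ) (v : L2) :
    linearizedOp hφ v =ᵐ[volume]
      fun x => ((c - φ x : ℝ) : ℂ) * v x - ∫ y, (greenFun (x - y) : ℂ) * v y := by
  filter_upwards [Lp.coeFn_sub (mulOp hφ.memLp_top_symbol v) (helmholtzInv v),
    coeFn_mulOp hφ.memLp_top_symbol v, coeFn_helmholtzInv v] with x h1 h2 h3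
  rw [linearizedOp, sub_apply, h1, Pi.sub_apply, h2, h3, greenConv]

end

/-!
No spectral theory of Schrödinger operators is needed: everything follows from the positivity of the
Green function and one explicit null vector.

*The profile.* The travelling wave equation integrates to `W' = (c - 1) φ - φ² / 2` with
`W = (c - φ) φ'`, and then to `W² = φ² (φ_max - φ) (φ₊ - φ) / 4`, where `φ_max < c < φ₊`
(`IsSolitaryWave.hasDerivAt_waveFlux`, `IsSolitaryWave.waveFlux_sq`). Hence `0 < φ ≤ φ_max < c`, the
only critical point is the crest at the origin, and `φ'` has opposite signs on the two half-lines.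
Since `W - W'' = φ'`, also `G ∗ φ' = (c - φ) φ'`, that is, `L φ' = 0`.

*Ground state representation.* Subtracting the rank one kernel `2 G(x) G(y)` from `G(x - y)` gives
the Dirichlet Green function `D`, which is nonnegative and vanishes unless `x` and `y` lie on the
same side of the origin. As `(G ∗ φ')(0) = 0`, both `φ'` and `p = |φ'|` satisfy `∫ D(x, y) p(y) dy =
(c - φ(x)) p(x)`, and expanding the square yields (`groundState_representation`)
`2 ⟨v, L v⟩ + 4 |⟨G, v⟩|² = ∬ D(x, y) p(x) p(y) |v(x)/p(x) - v(y)/p(y)|² dx dy ≥ 0`.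

*Consequences.* The operator `L + 2 |G⟩⟨G|` is nonnegative, so `L` is nonnegative up to a rank one
form. The vector `p` satisfies `⟨p, L p⟩ = -2 ⟨G, p⟩² < 0`, so `L` has negative spectrum, which a rank
one perturbation argument turns into an eigenvalue (`exists_neg_eigenvalue`); it is unique and simple
because two independent eigenvectors for negative eigenvalues would have a combination orthogonal to
`G` with negative form.
The same argument shows that the kernel is orthogonal to `G`; the right-hand side above then vanishes
on it, which leaves only combinations of `φ'` and `|φ'|`, and orthogonality to `G` excludes `|φ'|`
(`IsSolitaryWave.mem_span_deriv`). Finally `‖G ∗ ·‖ ≤ 1` gives the lower bound `λ₀` for eigenvalues.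
-/

/-! ### The profile of the solitary wave -/

/-- The flux `W = (c - φ) φ'`, that is, the derivative of `c φ - φ² / 2`. -/
noncomputable def waveFlux (c : ℝ) (φ : ℝ → ℝ) (x : ℝ) : ℝ := (c - φ x) * deriv φ x

/-- The upper root `2c - 4/3 + (2/3)√(4 - 3c)` of the quadratic whose lower root is `phiMax c`. -/
noncomputable def upperRoot (c : ℝ) : ℝ := 2 * c - 4 / 3 + 2 * Real.sqrt (4 - 3 * c) / 3

theorem sqrt_discriminant {c : ℝ} (hc₁ : 1 < c) (hc₂ : c < 4 / 3) :
    0 < √(4 - 3 * c) ∧ √(4 - 3 * c) < 1 ∧ √(4 - 3 * c) ^ 2 = 4 - 3 * c := by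
  have h2 : √(4 - 3 * c) ^ 2 = 4 - 3 * c := Real.sq_sqrt (by linarith)
  have h0 : 0 < √(4 - 3 * c) := Real.sqrt_pos.2 (by linarith)
  exact ⟨h0, by nlinarith, h2⟩

theorem phiMax_pos {c : ℝ} (hc₁ : 1 < c) (hc₂ : c < 4 / 3) : 0 < phiMax c := by
  obtain ⟨h0, h1, h2⟩ := sqrt_discriminant hc₁ hc₂
  unfold phiMax
  nlinarith

theorem phiMax_lt {c : ℝ} (hc₁ : 1 < c) (hc₂ : c < 4 / 3) : phiMax c < c := by
  obtain ⟨h0, h1, h2⟩ := sqrt_discriminant hc₁ hc₂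
  unfold phiMax
  nlinarith

theorem lt_upperRoot {c : ℝ} (hc₁ : 1 < c) (hc₂ : c < 4 / 3) : c < upperRoot c := by
  obtain ⟨h0, h1, h2⟩ := sqrt_discriminant hc₁ hc₂
  unfold upperRoot
  nlinarith

theorem phiMax_mul_upperRoot {c : ℝ} (hc₁ : 1 < c) (hc₂ : c < 4 / 3) (s : ℝ) :
    (phiMax c - s) * (upperRoot c - s) =
      s ^ 2 - 4 * (3 * c - 2) / 3 * s + 4 * c * (c - 1) := by
  obtain ⟨-, -, h2⟩ := sqrt_discriminant hc₁ hc₂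
  unfold phiMax upperRoot
  linear_combination (-4 / 9) * h2

/-- The second derivative of the profile does not vanish at the crest. -/
theorem two_mul_lt_phiMax {c : ℝ} (hc₁ : 1 < c) (hc₂ : c < 4 / 3) :
    2 * (c - 1) < phiMax c := by
  obtain ⟨h0, h1, h2⟩ := sqrt_discriminant hc₁ hc₂
  unfold phiMax
  nlinarith

namespace IsSolitaryWave

variable {c : ℝ} {φ : ℝ → ℝ}

theorem hasDerivAt (hφ : IsSolitaryWave c φ) (x : ℝ) : HasDerivAt φ (deriv φ x) x :=
  (hφ.smooth.differentiable (by simp) x).hasDerivAt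

theorem hasDerivAt_iteratedDeriv (hφ : IsSolitaryWave c φ) (n : ℕ) (x : ℝ) :
    HasDerivAt (iteratedDeriv n φ) (iteratedDeriv (n + 1) φ x) x := by
  rw [iteratedDeriv_succ]
  exact (hφ.smooth.differentiable_iteratedDeriv n
    (by exact_mod_cast WithTop.coe_lt_top _) x).hasDerivAt

theorem continuous (hφ : IsSolitaryWave c φ) : Continuous φ := hφ.smooth.continuous

theorem continuous_deriv (hφ : IsSolitaryWave c φ) : Continuous (deriv φ) :=
  hφ.smooth.continuous_deriv (by simp)

theorem hasDerivAt_deriv (hφ : IsSolitaryWave c φ) (x : ℝ) :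
    HasDerivAt (deriv φ) (iteratedDeriv 2 φ x) x := by
  have := hφ.hasDerivAt_iteratedDeriv 1 x
  rwa [iteratedDeriv_one] at this

theorem hasDerivAt_potential (hφ : IsSolitaryWave c φ) (x : ℝ) :
    HasDerivAt (fun x => c * φ x - φ x ^ 2 / 2) (waveFlux c φ x) x := by
  have h := hφ.hasDerivAt x
  refine ((h.const_mul c).sub ((h.pow 2).div_const 2)).congr_deriv ?_
  simp only [waveFlux, Nat.cast_ofNat]
  ring

/-- The travelling wave equation integrates once to `W' = (c - 1) φ - φ² / 2`. The constant of
integration vanishes because the second differences of `c φ - φ² / 2` tend to zero. -/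
theorem hasDerivAt_waveFlux (hφ : IsSolitaryWave c φ) (x : ℝ) :
    HasDerivAt (waveFlux c φ) ((c - 1) * φ x - φ x ^ 2 / 2) x := by
  have hW : ∀ x, HasDerivAt (waveFlux c φ)
      ((c - φ x) * iteratedDeriv 2 φ x - deriv φ x ^ 2) x := fun x => by
    refine (((hasDerivAt_const x c).sub (hφ.hasDerivAt x)).mul
      (hφ.hasDerivAt_deriv x)).congr_deriv ?_
    simp only [Pi.sub_apply]
    ring
  set E : ℝ → ℝ := fun x => (c - φ x) * iteratedDeriv 2 φ x - deriv φ x ^ 2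
    - ((c - 1) * φ x - φ x ^ 2 / 2) with hE
  have hE' : ∀ x, HasDerivAt E 0 x := fun x => by
    have h1 := hφ.hasDerivAt x
    have h := ((((hasDerivAt_const x c).sub h1).mul (hφ.hasDerivAt_iteratedDeriv 2 x)).sub
      ((hφ.hasDerivAt_deriv x).pow 2)).sub ((h1.const_mul (c - 1)).sub ((h1.pow 2).div_const 2))
    refine h.congr_deriv ?_
    have := hφ.travelling_wave x
    simp only [Pi.sub_apply, Nat.reduceAdd, Nat.cast_ofNat, Nat.reduceSub, pow_one]
    linear_combination this
  have hconst : ∀ x, E x = E 0 := fun x =>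
    is_const_of_deriv_eq_zero (fun x => (hE' x).differentiableAt) (fun x => (hE' x).deriv) x 0
  set K := E 0
  have hW' : ∀ x, HasDerivAt (waveFlux c φ) ((c - 1) * φ x - φ x ^ 2 / 2 + K) x := fun x => by
    refine (hW x).congr_deriv ?_
    simp only [K, ← hconst x, hE]
    ring
  set Θ : ℝ → ℝ := fun x => c * φ x - φ x ^ 2 / 2 with hΘ
  have hΘ0 : Tendsto Θ atTop (𝓝 0) := by
    simpa using (hφ.tendsto_atTop.const_mul c).sub ((hφ.tendsto_atTop.pow 2).div_const 2)
  have hsecond : ∀ x, ∃ y, x < y ∧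
      Θ (x + 2) - 2 * Θ (x + 1) + Θ x = (c - 1) * φ y - φ y ^ 2 / 2 + K := fun x => by
    have hg : ∀ z, HasDerivAt (fun z => Θ (z + 1) - Θ z)
        (waveFlux c φ (z + 1) - waveFlux c φ z) z := fun z =>
      ((hφ.hasDerivAt_potential (z + 1)).comp_add_const z 1).sub (hφ.hasDerivAt_potential z)
    obtain ⟨ξ, hξ, h1⟩ := exists_hasDerivAt_eq_slope _ _ (show x < x + 1 by linarith)
      (fun z _ => (hg z).continuousAt.continuousWithinAt) (fun z _ => hg z)
    obtain ⟨y, hy, h2⟩ := exists_hasDerivAt_eq_slope _ _ (show ξ < ξ + 1 by linarith)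
      (fun z _ => (hW' z).continuousAt.continuousWithinAt) (fun z _ => hW' z)
    refine ⟨y, hξ.1.trans hy.1, ?_⟩
    rw [h2, add_sub_cancel_left, div_one, h1, add_sub_cancel_left, div_one,
      show x + 1 + 1 = x + 2 by ring]
    ring
  choose y hy hy' using hsecond
  have hy_top : Tendsto y atTop atTop := tendsto_atTop_mono (fun x => (hy x).le) tendsto_id
  have hφy := hφ.tendsto_atTop.comp hy_top
  have lim1 : Tendsto (fun x => (c - 1) * φ (y x) - φ (y x) ^ 2 / 2 + K) atTop (𝓝 K) := by
    simpa using ((hφy.const_mul (c - 1)).sub ((hφy.pow 2).div_const 2)).add_const K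
  have lim2 : Tendsto (fun x => Θ (x + 2) - 2 * Θ (x + 1) + Θ x) atTop (𝓝 0) := by
    simpa using ((hΘ0.comp (tendsto_atTop_add_const_right _ 2 tendsto_id)).sub
      ((hΘ0.comp (tendsto_atTop_add_const_right _ 1 tendsto_id)).const_mul 2)).add hΘ0
  have hK : K = 0 := tendsto_nhds_unique lim1 (lim2.congr hy')
  simpa [hK] using hW' x

/-- The energy integral `W² = φ² (φ_max - φ) (φ₊ - φ) / 4`. -/
theorem waveFlux_sq (hc₁ : 1 < c) (hc₂ : c < 4 / 3) (hφ : IsSolitaryWave c φ) (x : ℝ) :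
    waveFlux c φ x ^ 2 = φ x ^ 2 * ((phiMax c - φ x) * (upperRoot c - φ x)) / 4 := by
  simp only [phiMax_mul_upperRoot hc₁ hc₂]
  set P : ℝ → ℝ := fun s => s ^ 2 * (s ^ 2 - 4 * (3 * c - 2) / 3 * s + 4 * c * (c - 1)) / 4 with hP
  have hP' : ∀ s, HasDerivAt P (2 * ((c - s) * ((c - 1) * s - s ^ 2 / 2))) s := fun s => by
    have h := ((hasDerivAt_id s).pow 2).mul ((((hasDerivAt_id s).pow 2).sub
      ((hasDerivAt_id s).const_mul (4 * (3 * c - 2) / 3))).add_const (4 * c * (c - 1)))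
    refine (h.div_const 4).congr_deriv ?_
    simp only [Pi.pow_apply, Pi.sub_apply, id, Nat.cast_ofNat, Nat.add_one_sub_one, pow_one]
    ring
  set F : ℝ → ℝ := fun x => waveFlux c φ x ^ 2 - P (φ x) with hF
  have hF' : ∀ x, HasDerivAt F 0 x := fun x => by
    refine (((hφ.hasDerivAt_waveFlux x).pow 2).sub
      ((hP' (φ x)).comp x (hφ.hasDerivAt x))).congr_deriv ?_
    simp only [waveFlux, Nat.cast_ofNat, Nat.add_one_sub_one, pow_one]
    ring
  have hconst : ∀ x, F x = F 0 := fun x =>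
    is_const_of_deriv_eq_zero (fun x => (hF' x).differentiableAt) (fun x => (hF' x).deriv) x 0
  -- Along points supplied by the mean value theorem the flux tends to zero.
  have hmean : ∀ x, ∃ y, x < y ∧ waveFlux c φ y =
      (c * φ (x + 1) - φ (x + 1) ^ 2 / 2) - (c * φ x - φ x ^ 2 / 2) := fun x => by
    obtain ⟨y, hy, h⟩ := exists_hasDerivAt_eq_slope _ _ (show x < x + 1 by linarith)
      (fun z _ => (hφ.hasDerivAt_potential z).continuousAt.continuousWithinAt)
      (fun z _ => hφ.hasDerivAt_potential z)
    exact ⟨y, hy.1, by rw [h, add_sub_cancel_left, div_one]⟩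
  choose y hy hy' using hmean
  have hy_top : Tendsto y atTop atTop := tendsto_atTop_mono (fun x => (hy x).le) tendsto_id
  have hΘ0 : Tendsto (fun x => c * φ x - φ x ^ 2 / 2) atTop (𝓝 0) := by
    simpa using (hφ.tendsto_atTop.const_mul c).sub ((hφ.tendsto_atTop.pow 2).div_const 2)
  have lim1 : Tendsto (fun x => waveFlux c φ (y x)) atTop (𝓝 0) := by
    simp only [hy']
    simpa using (hΘ0.comp (tendsto_atTop_add_const_right _ 1 tendsto_id)).sub hΘ0
  have lim2 : Tendsto (fun x => P (φ (y x))) atTop (𝓝 0) := by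
    have := ((hP' 0).continuousAt.tendsto).comp (hφ.tendsto_atTop.comp hy_top)
    simpa [hP, Function.comp_def] using this
  have lim3 : Tendsto (fun x => F (y x)) atTop (𝓝 0) := by
    simpa [hF] using (lim1.pow 2).sub lim2
  have h0 : F 0 = 0 := by
    simp only [hconst] at lim3
    exact tendsto_nhds_unique tendsto_const_nhds lim3
  have := hconst x
  rw [h0] at this
  exact sub_eq_zero.1 this

theorem le_phiMax (hc₁ : 1 < c) (hc₂ : c < 4 / 3) (hφ : IsSolitaryWave c φ) (x : ℝ) :
    φ x ≤ phiMax c := by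
  by_contra! hx
  have hm := phiMax_pos hc₁ hc₂
  have hM := (phiMax_lt hc₁ hc₂).trans (lt_upperRoot hc₁ hc₂)
  obtain ⟨s, hs1, hs2⟩ := exists_between (lt_min hx hM)
  obtain ⟨z, hz⟩ := (hφ.tendsto_atTop.eventually (gt_mem_nhds (hm.trans hs1))).exists
  obtain ⟨y, hy⟩ := mem_range_of_exists_le_of_exists_ge hφ.continuous ⟨z, hz.le⟩
    ⟨x, (hs2.trans_le (min_le_left _ _)).le⟩
  have h := hφ.waveFlux_sq hc₁ hc₂ y
  rw [hy] at h
  have h1 : 0 < s ^ 2 * ((s - phiMax c) * (upperRoot c - s)) :=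
    mul_pos (pow_pos (hm.trans hs1) 2)
      (mul_pos (by linarith) (by linarith [hs2.trans_le (min_le_right (φ x) (upperRoot c))]))
  nlinarith [sq_nonneg (waveFlux c φ y)]

theorem symbol_pos (hc₁ : 1 < c) (hc₂ : c < 4 / 3) (hφ : IsSolitaryWave c φ) (x : ℝ) :
    0 < c - φ x := by
  linarith [hφ.le_phiMax hc₁ hc₂ x, phiMax_lt hc₁ hc₂]

theorem exists_bound (hφ : IsSolitaryWave c φ) : ∃ B, 0 ≤ B ∧ ∀ x, |φ x| ≤ B := by
  have hlim : Tendsto φ (cocompact ℝ) (𝓝 0) := by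
    rw [cocompact_eq_atBot_atTop]
    exact hφ.tendsto_atBot.sup hφ.tendsto_atTop
  let f : ZeroAtInftyContinuousMap ℝ ℝ := ⟨⟨φ, hφ.continuous⟩, hlim⟩
  exact ⟨‖f.toBCF‖, norm_nonneg _, fun x => f.toBCF.norm_coe_le_norm x⟩

theorem exists_abs_deriv_le (hc₁ : 1 < c) (hc₂ : c < 4 / 3) (hφ : IsSolitaryWave c φ) :
    ∃ C, 0 ≤ C ∧ ∀ x, |deriv φ x| ≤ C * |φ x| := by
  obtain ⟨B, hB0, hB⟩ := hφ.exists_bound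
  have hm := phiMax_pos hc₁ hc₂
  have hmc := phiMax_lt hc₁ hc₂
  have hM := lt_upperRoot hc₁ hc₂
  set A := upperRoot c + B with hA
  have hd : 0 < c - phiMax c := by linarith
  have hA0 : 0 ≤ A := by linarith
  refine ⟨A / (c - phiMax c), by positivity, fun x => ?_⟩
  have hx := abs_le.1 (hB x)
  have h1 : waveFlux c φ x ^ 2 ≤ (A * |φ x|) ^ 2 := by
    rw [hφ.waveFlux_sq hc₁ hc₂, mul_pow, sq_abs]
    have h2 : (phiMax c - φ x) * (upperRoot c - φ x) ≤ A * A := by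
      refine mul_le_mul (by linarith) (by linarith) (by linarith [hφ.le_phiMax hc₁ hc₂ x])
        (by linarith)
    nlinarith [sq_nonneg (φ x), mul_le_mul_of_nonneg_left h2 (sq_nonneg (φ x)),
      mul_nonneg (sq_nonneg (φ x)) (sq_nonneg A)]
  have h3 : |waveFlux c φ x| ≤ A * |φ x| := by
    exact abs_le_of_sq_le_sq h1 (by positivity)
  rw [div_mul_eq_mul_div, le_div_iff₀ hd]
  refine le_trans ?_ h3
  rw [waveFlux, abs_mul, mul_comm]
  refine mul_le_mul_of_nonneg_right ?_ (abs_nonneg _)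
  exact (by linarith [hφ.le_phiMax hc₁ hc₂ x] : c - phiMax c ≤ c - φ x).trans (le_abs_self _)

/-- A zero of `φ` would propagate to the whole line, by a Gronwall estimate for `φ²`. -/
theorem ne_zero (hc₁ : 1 < c) (hc₂ : c < 4 / 3) (hφ : IsSolitaryWave c φ) (x : ℝ) : φ x ≠ 0 := by
  intro hx
  obtain ⟨C, hC0, hC⟩ := hφ.exists_abs_deriv_le hc₁ hc₂
  have hderiv : ∀ k y, HasDerivAt (fun y => φ y ^ 2 * Real.exp (k * y))
      ((2 * φ y * deriv φ y + k * φ y ^ 2) * Real.exp (k * y)) y := fun k y => by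
    refine (((hφ.hasDerivAt y).pow 2).mul ((hasDerivAt_id y).const_mul k).exp).congr_deriv ?_
    simp only [Pi.pow_apply, id, Nat.cast_ofNat, Nat.add_one_sub_one, pow_one]
    ring
  have hbound : ∀ y, |2 * φ y * deriv φ y| ≤ 2 * C * φ y ^ 2 := fun y => by
    rw [abs_mul, abs_mul, abs_two, ← sq_abs (φ y)]
    nlinarith [mul_le_mul_of_nonneg_left (hC y) (abs_nonneg (φ y))]
  have hmono : Monotone fun y => φ y ^ 2 * Real.exp (2 * C * y) :=
    monotone_of_hasDerivAt_nonneg (hderiv _) fun y =>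
      mul_nonneg (by linarith [(abs_le.1 (hbound y)).1]) (Real.exp_pos _).le
  have hanti : Antitone fun y => φ y ^ 2 * Real.exp (-(2 * C) * y) :=
    antitone_of_hasDerivAt_nonpos (hderiv _) fun y =>
      mul_nonpos_of_nonpos_of_nonneg (by linarith [(abs_le.1 (hbound y)).2]) (Real.exp_pos _).le
  obtain ⟨y, hy⟩ := hφ.nontrivial
  have hpos : 0 < φ y ^ 2 := by positivity
  rcases le_total x y with h | h
  · have := hanti h
    simp only [hx] at this
    nlinarith [Real.exp_pos (-(2 * C) * y), mul_pos hpos (Real.exp_pos (-(2 * C) * y))]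
  · have := hmono h
    simp only [hx] at this
    nlinarith [Real.exp_pos (2 * C * y), mul_pos hpos (Real.exp_pos (2 * C * y))]

/-- Critical points of the profile lie at the crest height. -/
theorem eq_phiMax_of_deriv_eq_zero (hc₁ : 1 < c) (hc₂ : c < 4 / 3) (hφ : IsSolitaryWave c φ)
    {x : ℝ} (hx : deriv φ x = 0) : φ x = phiMax c := by
  have h := hφ.waveFlux_sq hc₁ hc₂ x
  have h0 := hφ.ne_zero hc₁ hc₂ x
  have h1 : 0 < upperRoot c - φ x := by
    linarith [hφ.le_phiMax hc₁ hc₂ x, phiMax_lt hc₁ hc₂, lt_upperRoot hc₁ hc₂]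
  rw [waveFlux, hx, mul_zero, zero_pow two_ne_zero, eq_comm, div_eq_zero_iff] at h
  have : phiMax c - φ x = 0 := by simpa [h0, h1.ne'] using h
  linarith

/-- Two critical points would enclose a minimum, again at crest height, so that the profile would
be constant in between; this is incompatible with `W' ≠ 0` at crest height. -/
theorem not_two_critical_points (hc₁ : 1 < c) (hc₂ : c < 4 / 3) (hφ : IsSolitaryWave c φ) {a b : ℝ}
    (hab : a < b) (ha : deriv φ a = 0) (hb : deriv φ b = 0) : False := by
  obtain ⟨z, hz, hmin⟩ := isCompact_Icc.exists_isMinOn (Set.nonempty_Icc.2 hab.le)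
    hφ.continuous.continuousOn
  have hzm : φ z = phiMax c := by
    rcases eq_or_lt_of_le hz.1 with h | h
    · exact h ▸ hφ.eq_phiMax_of_deriv_eq_zero hc₁ hc₂ ha
    rcases eq_or_lt_of_le hz.2 with h' | h'
    · exact h' ▸ hφ.eq_phiMax_of_deriv_eq_zero hc₁ hc₂ hb
    exact hφ.eq_phiMax_of_deriv_eq_zero hc₁ hc₂
      (hmin.isLocalMin (Icc_mem_nhds h h')).deriv_eq_zero
  have heq : ∀ x ∈ Set.Ioo a b, φ x = phiMax c := fun x hx =>
    le_antisymm (hφ.le_phiMax hc₁ hc₂ x) (hzm ▸ hmin (Set.Ioo_subset_Icc_self hx))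
  have hd : ∀ x ∈ Set.Ioo a b, deriv φ x = 0 := fun x hx => by
    have : φ =ᶠ[𝓝 x] fun _ => phiMax c :=
      eventually_of_mem (Ioo_mem_nhds hx.1 hx.2) heq
    rw [this.deriv_eq, deriv_const]
  have hmid : (a + b) / 2 ∈ Set.Ioo a b := ⟨by linarith, by linarith⟩
  have hW : waveFlux c φ =ᶠ[𝓝 ((a + b) / 2)] fun _ => 0 :=
    eventually_of_mem (Ioo_mem_nhds hmid.1 hmid.2) fun x hx => by
      simp [waveFlux, hd x hx]
  have h1 := (hφ.hasDerivAt_waveFlux ((a + b) / 2)).unique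
    ((hasDerivAt_const _ (0 : ℝ)).congr_of_eventuallyEq hW)
  rw [heq _ hmid] at h1
  nlinarith [phiMax_pos hc₁ hc₂, two_mul_lt_phiMax hc₁ hc₂]

theorem deriv_ne_zero (hc₁ : 1 < c) (hc₂ : c < 4 / 3) (hφ : IsSolitaryWave c φ) {x : ℝ}
    (hx : x ≠ 0) : deriv φ x ≠ 0 := fun h => by
  rcases lt_or_gt_of_ne hx with h' | h'
  · exact hφ.not_two_critical_points hc₁ hc₂ h' h hφ.deriv_zero
  · exact hφ.not_two_critical_points hc₁ hc₂ h' hφ.deriv_zero h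

theorem deriv_neg (hc₁ : 1 < c) (hc₂ : c < 4 / 3) (hφ : IsSolitaryWave c φ) {x : ℝ}
    (hx : 0 < x) : deriv φ x < 0 := by
  by_contra! h
  have hpos : ∀ y ∈ Set.Ioi (0 : ℝ), 0 < deriv φ y := fun y hy => by
    by_contra! h'
    obtain ⟨z, hz, hz'⟩ := isPreconnected_Ioi.intermediate_value (Set.mem_Ioi.2 hy)
      (Set.mem_Ioi.2 hx) hφ.continuous_deriv.continuousOn ⟨h', h⟩
    exact hφ.deriv_ne_zero hc₁ hc₂ (ne_of_gt hz) hz'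
  have hmono : StrictMonoOn φ (Set.Ici 0) :=
    strictMonoOn_of_deriv_pos (convex_Ici 0) hφ.continuous.continuousOn
      (by simpa [interior_Ici] using hpos)
  have h1 := hmono Set.self_mem_Ici (Set.mem_Ici.2 hx.le) hx
  rw [hφ.eq_phiMax_of_deriv_eq_zero hc₁ hc₂ hφ.deriv_zero] at h1
  exact absurd (hφ.le_phiMax hc₁ hc₂ x) (not_le.2 h1)

theorem deriv_pos (hc₁ : 1 < c) (hc₂ : c < 4 / 3) (hφ : IsSolitaryWave c φ) {x : ℝ}
    (hx : x < 0) : 0 < deriv φ x := by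
  by_contra! h
  have hneg : ∀ y ∈ Set.Iio (0 : ℝ), deriv φ y < 0 := fun y hy => by
    by_contra! h'
    obtain ⟨z, hz, hz'⟩ := isPreconnected_Iio.intermediate_value (Set.mem_Iio.2 hx)
      (Set.mem_Iio.2 hy) hφ.continuous_deriv.continuousOn ⟨h, h'⟩
    exact hφ.deriv_ne_zero hc₁ hc₂ (ne_of_lt hz) hz'
  have hanti : StrictAntiOn φ (Set.Iic 0) :=
    strictAntiOn_of_deriv_neg (convex_Iic 0) hφ.continuous.continuousOn
      (by simpa [interior_Iic] using hneg)
  have h1 := hanti (Set.mem_Iic.2 hx.le) Set.self_mem_Iic hx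
  rw [hφ.eq_phiMax_of_deriv_eq_zero hc₁ hc₂ hφ.deriv_zero] at h1
  exact absurd (hφ.le_phiMax hc₁ hc₂ x) (not_le.2 h1)

theorem lt_phiMax (hc₁ : 1 < c) (hc₂ : c < 4 / 3) (hφ : IsSolitaryWave c φ) {x : ℝ}
    (hx : x ≠ 0) : φ x < phiMax c := by
  refine (hφ.le_phiMax hc₁ hc₂ x).lt_of_ne fun h => hφ.deriv_ne_zero hc₁ hc₂ hx ?_
  have h1 := hφ.waveFlux_sq hc₁ hc₂ x
  rw [h, sub_self, zero_mul, mul_zero, zero_div] at h1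
  exact (mul_eq_zero.1 (pow_eq_zero_iff two_ne_zero |>.1 h1)).resolve_left
    (hφ.symbol_pos hc₁ hc₂ x).ne'

theorem integrable_deriv (hc₁ : 1 < c) (hc₂ : c < 4 / 3) (hφ : IsSolitaryWave c φ) :
    Integrable (deriv φ) := by
  have h1 : IntegrableOn (deriv φ) (Set.Ioi 0) :=
    integrableOn_Ioi_deriv_of_nonpos hφ.continuous.continuousWithinAt
      (fun x _ => hφ.hasDerivAt x) (fun x hx => (hφ.deriv_neg hc₁ hc₂ hx).le) hφ.tendsto_atTop
  have h2 : IntegrableOn (fun x => -deriv φ (-x)) (Set.Ioi 0) :=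
    integrableOn_Ioi_deriv_of_nonpos (g := fun x => φ (-x))
      (hφ.continuous.comp continuous_neg).continuousWithinAt
      (fun x _ => ((hφ.hasDerivAt (-x)).scomp x (hasDerivAt_neg x)).congr_deriv (by simp))
      (fun x hx => by
        have := hφ.deriv_pos hc₁ hc₂ (x := -x) (by simpa using hx)
        linarith)
      (hφ.tendsto_atBot.comp tendsto_neg_atTop_atBot)
  have h3 : IntegrableOn (deriv φ) (Set.Iic 0) := by
    have h4 : IntegrableOn (fun x => deriv φ (-x)) (Set.Ioi 0) := by simpa using h2.neg
    have h5 := h4.integrable_indicator measurableSet_Ioi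
    rw [integrableOn_Iic_iff_integrableOn_Iio, ← integrable_indicator_iff measurableSet_Iio]
    refine h5.comp_neg.congr (.of_forall fun x => ?_)
    simp [Set.indicator_apply]
  rw [← integrableOn_univ, ← Set.Iic_union_Ioi (a := (0 : ℝ))]
  exact h3.union h1

theorem memLp_deriv (hc₁ : 1 < c) (hc₂ : c < 4 / 3) (hφ : IsSolitaryWave c φ) :
    MemLp (fun x => ((deriv φ x : ℝ) : ℂ)) 2 volume := by
  obtain ⟨B, hB0, hB⟩ := hφ.exists_bound
  obtain ⟨C, hC0, hC⟩ := hφ.exists_abs_deriv_le hc₁ hc₂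
  have hc := hφ.continuous_deriv
  have hm : AEStronglyMeasurable (fun x => ((deriv φ x : ℝ) : ℂ)) volume :=
    Continuous.aestronglyMeasurable (by fun_prop)
  rw [memLp_two_iff_integrable_sq_norm hm]
  refine ((hφ.integrable_deriv hc₁ hc₂).norm.const_mul (C * B)).mono'
    (Continuous.aestronglyMeasurable (by fun_prop)) (.of_forall fun x => ?_)
  rw [Complex.norm_real, Real.norm_of_nonneg (by positivity), sq]
  exact mul_le_mul_of_nonneg_right
    ((hC x).trans (mul_le_mul_of_nonneg_left (hB x) hC0)) (norm_nonneg _)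

end IsSolitaryWave

/-! ### The derivative of the profile under convolution with the Green function -/

theorem greenFun_neg (x : ℝ) : greenFun (-x) = greenFun x := by
  simp [greenFun]

theorem greenFun_pos (x : ℝ) : 0 < greenFun x := by
  unfold greenFun; positivity

theorem greenConv_ofReal (f : ℝ → ℝ) (x : ℝ) :
    greenConv (fun y => ((f y : ℝ) : ℂ)) x = ((∫ y, greenFun (x - y) * f y : ℝ) : ℂ) := by
  rw [greenConv, ← integral_complex_ofReal]
  simp

theorem integrable_greenFun_mul_real {f : ℝ → ℝ}
    (hf : MemLp (fun y => ((f y : ℝ) : ℂ)) 2 volume) (x : ℝ) :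
    Integrable fun y => greenFun (x - y) * f y := by
  simpa using (integrable_greenConv hf x).re

namespace IsSolitaryWave

variable {c : ℝ} {φ : ℝ → ℝ}

theorem tendsto_waveFlux (hc₁ : 1 < c) (hc₂ : c < 4 / 3) (hφ : IsSolitaryWave c φ) {l : Filter ℝ}
    (h : Tendsto φ l (𝓝 0)) : Tendsto (waveFlux c φ) l (𝓝 0) := by
  obtain ⟨C, hC0, hC⟩ := hφ.exists_abs_deriv_le hc₁ hc₂
  have h1 : Tendsto (deriv φ) l (𝓝 0) :=
    squeeze_zero_norm hC (by simpa using h.abs.const_mul C)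
  have h2 := (h.const_sub c).mul h1
  rwa [mul_zero] at h2

/-- Differentiating `(1 - ∂²)(c φ - φ² / 2) = φ` shows that `W = (c - φ) φ'` is the bounded solution
of `W - W'' = φ'`. -/
theorem greenConv_deriv (hc₁ : 1 < c) (hc₂ : c < 4 / 3) (hφ : IsSolitaryWave c φ) (x : ℝ) :
    ∫ y, greenFun (x - y) * deriv φ y = (c - φ x) * deriv φ x := by
  set W := waveFlux c φ with hW
  set V : ℝ → ℝ := fun y => (c - 1) * φ y - φ y ^ 2 / 2 with hV
  have hint := integrable_greenFun_mul_real (hφ.memLp_deriv hc₁ hc₂) x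
  have hWd : ∀ y, HasDerivAt W (V y) y := hφ.hasDerivAt_waveFlux
  have hVd : ∀ y, HasDerivAt V ((c - 1) * deriv φ y - φ y * deriv φ y) y := fun y => by
    have h := hφ.hasDerivAt y
    refine ((h.const_mul (c - 1)).sub ((h.pow 2).div_const 2)).congr_deriv ?_
    simp only [Nat.cast_ofNat, Nat.add_one_sub_one, pow_one]
    ring
  have hV0 : ∀ {l : Filter ℝ}, Tendsto φ l (𝓝 0) → Tendsto V l (𝓝 0) := fun h => by
    simpa using (h.const_mul (c - 1)).sub ((h.pow 2).div_const 2)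
  have hleft : ∫ y in Set.Iic x, greenFun (x - y) * deriv φ y = (W x - V x) / 2 := by
    have hd : ∀ y, HasDerivAt (fun y => Real.exp (y - x) / 2 * (W y - V y))
        (Real.exp (y - x) / 2 * deriv φ y) y := fun y => by
      refine ((((hasDerivAt_id y).sub_const x).exp.div_const 2).mul
        ((hWd y).sub (hVd y))).congr_deriv ?_
      simp only [hW, hV, waveFlux, Pi.sub_apply, id]
      ring
    have heq : Set.EqOn (fun y => greenFun (x - y) * deriv φ y)
        (fun y => Real.exp (y - x) / 2 * deriv φ y) (Set.Iic x) := fun y hy => by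
      simp only [greenFun, abs_of_nonneg (sub_nonneg.2 (Set.mem_Iic.1 hy)), neg_sub]
    have hlim : Tendsto (fun y => Real.exp (y - x) / 2 * (W y - V y)) atBot (𝓝 0) := by
      have h1 := (Real.tendsto_exp_atBot.comp
        (tendsto_atBot_add_const_right _ (-x) tendsto_id)).div_const 2
      have h2 := (hφ.tendsto_waveFlux hc₁ hc₂ hφ.tendsto_atBot).sub (hV0 hφ.tendsto_atBot)
      simpa [← sub_eq_add_neg] using h1.mul h2
    rw [setIntegral_congr_fun measurableSet_Iic heq,
      integral_Iic_of_hasDerivAt_of_tendsto (hd x).continuousAt.continuousWithinAt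
        (fun y _ => hd y) (hint.integrableOn.congr_fun heq measurableSet_Iic) hlim]
    simp
    ring
  have hright : ∫ y in Set.Ioi x, greenFun (x - y) * deriv φ y = (W x + V x) / 2 := by
    have hd : ∀ y, HasDerivAt (fun y => -(Real.exp (x - y) / 2 * (W y + V y)))
        (Real.exp (x - y) / 2 * deriv φ y) y := fun y => by
      refine ((((hasDerivAt_id y).const_sub x).exp.div_const 2).mul
        ((hWd y).add (hVd y))).neg.congr_deriv ?_
      simp only [hW, hV, waveFlux, Pi.add_apply, id]
      ring
    have heq : Set.EqOn (fun y => greenFun (x - y) * deriv φ y)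
        (fun y => Real.exp (x - y) / 2 * deriv φ y) (Set.Ioi x) := fun y hy => by
      simp only [greenFun, abs_of_nonpos (sub_nonpos.2 (Set.mem_Ioi.1 hy).le), neg_neg]
    have hlim : Tendsto (fun y => -(Real.exp (x - y) / 2 * (W y + V y))) atTop (𝓝 0) := by
      have h1 := (Real.tendsto_exp_atBot.comp
        (tendsto_atBot_add_const_left _ x tendsto_neg_atTop_atBot)).div_const 2
      have h2 := (hφ.tendsto_waveFlux hc₁ hc₂ hφ.tendsto_atTop).add (hV0 hφ.tendsto_atTop)
      simpa [← sub_eq_add_neg] using (h1.mul h2).neg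
    rw [setIntegral_congr_fun measurableSet_Ioi heq,
      integral_Ioi_of_hasDerivAt_of_tendsto (hd x).continuousAt.continuousWithinAt
        (fun y _ => hd y) (hint.integrableOn.congr_fun heq measurableSet_Ioi) hlim]
    simp
    ring
  rw [← intervalIntegral.integral_Iic_add_Ioi hint.integrableOn hint.integrableOn, hleft, hright]
  change _ = W x
  ring

end IsSolitaryWave

/-! ### Self-adjointness -/

theorem integrable_greenFun_mul_snd {h : ℝ → ℝ} (hh : Integrable h) :
    Integrable (fun z : ℝ × ℝ => greenFun (z.1 - z.2) * h z.2) (volume.prod volume) := by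
  have := hh.convolution_integrand (ContinuousLinearMap.mul ℝ ℝ) integrable_greenFun
  simpa [mul_comm] using this

theorem integrable_greenFun_mul_fst {h : ℝ → ℝ} (hh : Integrable h) :
    Integrable (fun z : ℝ × ℝ => greenFun (z.1 - z.2) * h z.1) (volume.prod volume) := by
  refine (integrable_greenFun_mul_snd hh).swap.congr (.of_forall fun z => ?_)
  simp only [Function.comp_apply, Prod.fst_swap, Prod.snd_swap]
  rw [← neg_sub, greenFun_neg]

theorem integrable_greenFun_pairing {u v : ℝ → ℂ} (hu : MemLp u 2 volume)
    (hv : MemLp v 2 volume) :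
    Integrable (fun z : ℝ × ℝ => (greenFun (z.1 - z.2) : ℂ) * v z.2 * (starRingEnd ℂ) (u z.1))
      (volume.prod volume) := by
  have hc := continuous_greenFun
  have hu2 := (memLp_two_iff_integrable_sq_norm hu.1).1 hu
  have hv2 := (memLp_two_iff_integrable_sq_norm hv.1).1 hv
  have hm : AEStronglyMeasurable (fun z : ℝ × ℝ => (greenFun (z.1 - z.2) : ℂ))
      (volume.prod volume) := Continuous.aestronglyMeasurable (by fun_prop)
  refine ((integrable_greenFun_mul_fst hu2).add (integrable_greenFun_mul_snd hv2)).mono'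
    ((hm.mul hv.1.comp_snd).mul (RCLike.continuous_conj.comp_aestronglyMeasurable hu.1.comp_fst))
    (.of_forall fun z => ?_)
  simp only [norm_mul, RCLike.norm_conj, Complex.norm_real, Pi.add_apply,
    Real.norm_of_nonneg (greenFun_nonneg _)]
  rw [← mul_add, mul_assoc]
  refine mul_le_mul_of_nonneg_left ?_ (greenFun_nonneg _)
  nlinarith [sq_nonneg (‖u z.1‖ - ‖v z.2‖), sq_nonneg (‖u z.1‖ + ‖v z.2‖)]

theorem integral_greenConv_mul_conj {u v : ℝ → ℂ} (hu : MemLp u 2 volume)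
    (hv : MemLp v 2 volume) :
    ∫ x, greenConv v x * (starRingEnd ℂ) (u x) =
      ∫ z : ℝ × ℝ, (greenFun (z.1 - z.2) : ℂ) * v z.2 * (starRingEnd ℂ) (u z.1)
        ∂(volume.prod volume) := by
  rw [integral_prod _ (integrable_greenFun_pairing hu hv)]
  refine integral_congr_ae (.of_forall fun x => ?_)
  simp only [greenConv, ← integral_mul_const]

theorem inner_helmholtzInv (u v : L2) :
    inner ℂ u (helmholtzInv v) = ∫ x, greenConv v x * (starRingEnd ℂ) (u x) := by
  rw [L2.inner_def]
  refine integral_congr_ae ?_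
  filter_upwards [coeFn_helmholtzInv v] with x hx
  rw [RCLike.inner_apply, hx]

theorem isSelfAdjoint_helmholtzInv : IsSelfAdjoint helmholtzInv := by
  rw [ContinuousLinearMap.isSelfAdjoint_iff_isSymmetric]
  intro u v
  simp only [ContinuousLinearMap.coe_coe]
  rw [← inner_conj_symm, inner_helmholtzInv, inner_helmholtzInv,
    integral_greenConv_mul_conj (Lp.memLp u) (Lp.memLp v),
    integral_greenConv_mul_conj (Lp.memLp v) (Lp.memLp u), ← integral_conj,
    ← integral_prod_swap]
  refine integral_congr_ae (.of_forall fun z => ?_)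
  simp only [Prod.fst_swap, Prod.snd_swap, map_mul, Complex.conj_ofReal, Complex.conj_conj]
  rw [← neg_sub, greenFun_neg]
  ring

theorem inner_mulOp {m : ℝ → ℂ} (hm : MemLp m ∞ volume) (u v : L2) :
    inner ℂ u (mulOp hm v) = ∫ x, m x * v x * (starRingEnd ℂ) (u x) := by
  rw [L2.inner_def]
  refine integral_congr_ae ?_
  filter_upwards [coeFn_mulOp hm v] with x hx
  rw [RCLike.inner_apply, hx]

theorem isSelfAdjoint_mulOp_ofReal {m : ℝ → ℝ} (hm : MemLp (fun x => ((m x : ℝ) : ℂ)) ∞ volume) :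
    IsSelfAdjoint (mulOp hm) := by
  rw [ContinuousLinearMap.isSelfAdjoint_iff_isSymmetric]
  intro u v
  simp only [ContinuousLinearMap.coe_coe]
  rw [← inner_conj_symm, inner_mulOp, inner_mulOp, ← integral_conj]
  refine integral_congr_ae (.of_forall fun z => ?_)
  simp only [map_mul, Complex.conj_ofReal, Complex.conj_conj]
  ring

theorem isSelfAdjoint_linearizedOp {c : ℝ} {φ : ℝ → ℝ} (hφ : IsSolitaryWave c φ) :
    IsSelfAdjoint (linearizedOp hφ) :=
  (isSelfAdjoint_mulOp_ofReal hφ.memLp_top_symbol).sub isSelfAdjoint_helmholtzInv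

/-! ### The Dirichlet Green function and the ground state representation -/

/-- The Green function of `1 - ∂²` with a Dirichlet condition at the origin. It differs from
`greenFun (x - y)` by a kernel of rank one. -/
noncomputable def dirichletGreen (x y : ℝ) : ℝ := greenFun (x - y) - 2 * greenFun x * greenFun y

theorem dirichletGreen_comm (x y : ℝ) : dirichletGreen x y = dirichletGreen y x := by
  unfold dirichletGreen
  rw [← neg_sub y x, greenFun_neg]
  ring

theorem continuous_dirichletGreen : Continuous fun z : ℝ × ℝ => dirichletGreen z.1 z.2 := by
  have := continuous_greenFun
  unfold dirichletGreen
  fun_prop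

theorem two_mul_greenFun_mul_greenFun (x y : ℝ) :
    2 * greenFun x * greenFun y = Real.exp (-(|x| + |y|)) / 2 := by
  rw [neg_add, Real.exp_add]
  unfold greenFun
  ring

theorem dirichletGreen_nonneg (x y : ℝ) : 0 ≤ dirichletGreen x y := by
  rw [dirichletGreen, two_mul_greenFun_mul_greenFun, greenFun]
  have : Real.exp (-(|x| + |y|)) ≤ Real.exp (-|x - y|) :=
    Real.exp_le_exp.2 (neg_le_neg (abs_sub x y))
  linarith

theorem dirichletGreen_pos {x y : ℝ} (h : 0 < x * y) : 0 < dirichletGreen x y := by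
  rw [dirichletGreen, two_mul_greenFun_mul_greenFun, greenFun]
  have h1 : |x - y| < |x| + |y| := by
    rcases pos_and_pos_or_neg_and_neg_of_mul_pos h with ⟨hx, hy⟩ | ⟨hx, hy⟩
    · rw [abs_of_pos hx, abs_of_pos hy, abs_lt]
      constructor <;> linarith
    · rw [abs_of_neg hx, abs_of_neg hy, abs_lt]
      constructor <;> linarith
  have : Real.exp (-(|x| + |y|)) < Real.exp (-|x - y|) := Real.exp_lt_exp.2 (neg_lt_neg h1)
  linarith

/-- The Dirichlet condition decouples the two half-lines. -/
theorem dirichletGreen_eq_zero {x y : ℝ} (h : x * y ≤ 0) : dirichletGreen x y = 0 := by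
  rw [dirichletGreen, two_mul_greenFun_mul_greenFun, greenFun]
  have h1 : |x - y| = |x| + |y| := by
    rcases mul_nonpos_iff.1 h with ⟨hx, hy⟩ | ⟨hx, hy⟩
    · rw [abs_of_nonneg hx, abs_of_nonpos hy, abs_of_nonneg (by linarith)]
      ring
    · rw [abs_of_nonpos hx, abs_of_nonneg hy, abs_of_nonpos (by linarith)]
      ring
  rw [h1, sub_self]

theorem greenConv_zero (v : ℝ → ℂ) : greenConv v 0 = ∫ y, (greenFun y : ℂ) * v y := by
  simp only [greenConv, zero_sub, greenFun_neg]

theorem integrable_greenFun_mul {v : ℝ → ℂ} (hv : MemLp v 2 volume) :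
    Integrable fun y => (greenFun y : ℂ) * v y := by
  simpa only [zero_sub, greenFun_neg] using integrable_greenConv hv 0

theorem integrable_dirichletGreen_pairing {v : ℝ → ℂ} (hv : MemLp v 2 volume) :
    Integrable (fun z : ℝ × ℝ => (dirichletGreen z.1 z.2 : ℂ) * v z.2 * (starRingEnd ℂ) (v z.1))
        (volume.prod volume) ∧
      ∫ z : ℝ × ℝ, (dirichletGreen z.1 z.2 : ℂ) * v z.2 * (starRingEnd ℂ) (v z.1)
        ∂(volume.prod volume) =
      (∫ x, greenConv v x * (starRingEnd ℂ) (v x)) - 2 * (‖greenConv v 0‖ ^ 2 : ℝ) := by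
  have h1 := integrable_greenFun_pairing hv hv
  have hg := integrable_greenFun_mul hv
  have hg' : Integrable fun y => (greenFun y : ℂ) * (starRingEnd ℂ) (v y) := by
    simpa using Complex.conjCLE.toContinuousLinearMap.integrable_comp hg
  have h2 := (hg'.mul_prod hg).const_mul 2
  have heq : (fun z : ℝ × ℝ => (dirichletGreen z.1 z.2 : ℂ) * v z.2 * (starRingEnd ℂ) (v z.1)) =
      fun z => (greenFun (z.1 - z.2) : ℂ) * v z.2 * (starRingEnd ℂ) (v z.1) -
        2 * ((greenFun z.1 : ℂ) * (starRingEnd ℂ) (v z.1) * ((greenFun z.2 : ℂ) * v z.2)) := by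
    funext z
    simp only [dirichletGreen]
    push_cast
    ring
  rw [heq]
  refine ⟨h1.sub h2, ?_⟩
  rw [integral_sub h1 h2, integral_greenConv_mul_conj hv hv, integral_const_mul,
    integral_prod_mul (fun x => (greenFun x : ℂ) * (starRingEnd ℂ) (v x))
      (fun y => (greenFun y : ℂ) * v y), greenConv_zero]
  congr 2
  have hconj : ∫ x, (greenFun x : ℂ) * (starRingEnd ℂ) (v x) =
      (starRingEnd ℂ) (∫ x, (greenFun x : ℂ) * v x) := by
    rw [← integral_conj]
    simp
  rw [hconj, ← Complex.normSq_eq_conj_mul_self, Complex.normSq_eq_norm_sq]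

/-- Ground state representation: if `p > 0` satisfies `∫ D(x, y) p(y) dy = b(x) p(x)` for the
Dirichlet Green function `D`, then the quadratic form of `b - G ∗`, corrected by the rank one form
that turns `G` into `D`, is half of the manifestly nonnegative integral of
`D(x, y) p(x) p(y) |v(x)/p(x) - v(y)/p(y)|²`. -/
theorem groundState_representation {b p : ℝ → ℝ} {v : ℝ → ℂ} (hp : Measurable p)
    (hpos : ∀ᵐ x, 0 < p x) (hint : ∀ x, Integrable fun y => dirichletGreen x y * p y)
    (hD : ∀ x, ∫ y, dirichletGreen x y * p y = b x * p x)
    (hv : MemLp v 2 volume) (hbv : Integrable fun x => b x * ‖v x‖ ^ 2) :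
    Integrable (fun z : ℝ × ℝ => dirichletGreen z.1 z.2 * (p z.1 * p z.2) *
        ‖v z.1 / p z.1 - v z.2 / p z.2‖ ^ 2) (volume.prod volume) ∧
      ∫ z : ℝ × ℝ, dirichletGreen z.1 z.2 * (p z.1 * p z.2) *
        ‖v z.1 / p z.1 - v z.2 / p z.2‖ ^ 2 ∂(volume.prod volume) =
      2 * ((∫ x, b x * ‖v x‖ ^ 2) - (∫ x, greenConv v x * (starRingEnd ℂ) (v x)).re) +
        4 * ‖greenConv v 0‖ ^ 2 := by
  set A : ℝ × ℝ → ℝ := fun z => dirichletGreen z.1 z.2 * p z.2 * (‖v z.1‖ ^ 2 * (p z.1)⁻¹) with hA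
  have hAm : AEStronglyMeasurable A (volume.prod volume) :=
    (continuous_dirichletGreen.aestronglyMeasurable.mul
      (hp.comp measurable_snd).aestronglyMeasurable).mul
      ((hv.1.comp_fst.norm.pow 2).mul (hp.comp measurable_fst).inv.aestronglyMeasurable)
  have hrow : ∀ᵐ x, ∫ y, A (x, y) = b x * ‖v x‖ ^ 2 := hpos.mono fun x hx => by
    simp only [hA, integral_mul_const, hD]
    field_simp
  have hAi : Integrable A (volume.prod volume) := by
    refine (integrable_prod_iff hAm).2 ⟨.of_forall fun x => (hint x).mul_const (‖v x‖ ^ 2 * (p x)⁻¹), ?_⟩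
    refine hbv.congr ?_
    filter_upwards [hrow, hpos] with x hx hpx
    rw [← hx]
    refine integral_congr_ae (hpos.mono fun y hy => ?_)
    exact (Real.norm_of_nonneg (mul_nonneg (mul_nonneg (dirichletGreen_nonneg _ _) hy.le)
      (by positivity))).symm
  have hAint : ∫ z, A z ∂(volume.prod volume) = ∫ x, b x * ‖v x‖ ^ 2 := by
    rw [integral_prod _ hAi]
    exact integral_congr_ae hrow
  obtain ⟨hCi, hCint⟩ := integrable_dirichletGreen_pairing hv
  set C : ℝ × ℝ → ℂ :=
    fun z => (dirichletGreen z.1 z.2 : ℂ) * v z.2 * (starRingEnd ℂ) (v z.1) with hC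
  have hre : ∫ z, (C z).re ∂(volume.prod volume) =
      (∫ x, greenConv v x * (starRingEnd ℂ) (v x)).re - 2 * ‖greenConv v 0‖ ^ 2 := by
    rw [show ∫ z, (C z).re ∂(volume.prod volume) = (∫ z, C z ∂(volume.prod volume)).re from
      integral_re hCi, hCint]
    simp [-Complex.ofReal_pow]
  have hae : (fun z => A z + A z.swap - 2 * (C z).re) =ᵐ[volume.prod volume]
      fun z : ℝ × ℝ => dirichletGreen z.1 z.2 * (p z.1 * p z.2) *
        ‖v z.1 / p z.1 - v z.2 / p z.2‖ ^ 2 := by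
    filter_upwards [Measure.quasiMeasurePreserving_fst.ae hpos,
      Measure.quasiMeasurePreserving_snd.ae hpos] with z h1 h2
    simp only [hA, hC, Prod.fst_swap, Prod.snd_swap, dirichletGreen_comm z.2 z.1]
    simp only [← Complex.normSq_eq_norm_sq, Complex.normSq_apply, Complex.sub_re, Complex.sub_im,
      Complex.div_ofReal_re, Complex.div_ofReal_im, Complex.mul_re, Complex.mul_im,
      Complex.conj_re, Complex.conj_im, Complex.ofReal_re, Complex.ofReal_im]
    field_simp
    ring
  have hAs : Integrable (fun z : ℝ × ℝ => A z.swap) (volume.prod volume) := hAi.swap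
  have hCre : Integrable (fun z => 2 * (C z).re) (volume.prod volume) := hCi.re.const_mul 2
  have hAsint : ∫ z : ℝ × ℝ, A z.swap ∂(volume.prod volume) = ∫ x, b x * ‖v x‖ ^ 2 :=
    (integral_prod_swap A).trans hAint
  refine ⟨((hAi.add hAs).sub hCre).congr hae, ?_⟩
  rw [← integral_congr_ae hae, integral_sub (f := fun z => A z + A z.swap) (hAi.add hAs) hCre,
    integral_add hAi hAs, integral_const_mul, hre, hAint, hAsint]
  ring

/-! ### Self-adjoint operators that are nonnegative up to a rank one form -/

section RankOne

open InnerProductSpace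

variable {H : Type*} [NormedAddCommGroup H] [InnerProductSpace ℂ H]

theorem hasEigenvalue_iff_exists_apply_eq_smul {L : H →L[ℂ] H} {z : ℂ} :
    Module.End.HasEigenvalue (L : H →ₗ[ℂ] H) z ↔ ∃ e, e ≠ 0 ∧ L e = z • e := by
  constructor
  · intro h
    obtain ⟨e, he⟩ := h.exists_hasEigenvector
    exact ⟨e, he.2, Module.End.mem_eigenspace_iff.1 he.1⟩
  · rintro ⟨e, he, hL⟩
    exact Module.End.hasEigenvalue_of_hasEigenvector (x := e)
      ⟨Module.End.mem_eigenspace_iff.2 hL, he⟩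

theorem re_inner_smul_self (v : H) (ν : ℝ) :
    (inner ℂ v ((ν : ℂ) • v)).re = ν * ‖v‖ ^ 2 := by
  rw [inner_smul_right, inner_self_eq_norm_sq_to_K, ← RCLike.ofReal_pow]
  simp [-Complex.ofReal_pow]

/-- If `L + k |γ⟩⟨γ|` is nonnegative and `L` is not, then `L` has a negative eigenvalue: for `μ < 0`
in the spectrum of `L`, the operator `L - μ` differs by rank one from the invertible operator
`S = L + k |γ⟩⟨γ| - μ`, and a rank one perturbation of an invertible operator fails to be
invertible only when `S⁻¹ γ` lies in its kernel. -/
theorem exists_neg_eigenvalue [CompleteSpace H] {L : H →L[ℂ] H} (hL : IsSelfAdjoint L) {γ : H}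
    {k : ℝ} (hT : ∀ v, 0 ≤ (inner ℂ v (L v)).re + k * ‖inner ℂ γ v‖ ^ 2)
    {u : H} (hu : (inner ℂ u (L u)).re < 0) :
    ∃ μ : ℝ, μ < 0 ∧ ∃ e, e ≠ 0 ∧ L e = (μ : ℂ) • e := by
  obtain ⟨μ, hμ, hμ0⟩ : ∃ μ ∈ spectrum ℝ L, μ < 0 := by
    by_contra! h
    have h1 : 0 ≤ L := (StarOrderedRing.nonneg_iff_spectrum_nonneg (R := ℝ) L hL).2 h
    have h2 := ((ContinuousLinearMap.nonneg_iff_isPositive L).1 h1).re_inner_nonneg_right u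
    exact absurd hu (not_lt.2 h2)
  refine ⟨μ, hμ0, ?_⟩
  have hinner : ∀ v, (inner ℂ v ((k : ℂ) • rankOne ℂ γ γ v)).re = k * ‖inner ℂ γ v‖ ^ 2 := by
    intro v
    rw [rankOne_apply, inner_smul_right, inner_smul_right, ← inner_conj_symm v γ,
      RCLike.mul_conj, ← RCLike.ofReal_pow]
    simp [-Complex.ofReal_pow]
  set T : H →L[ℂ] H := L + (k : ℂ) • rankOne ℂ γ γ with hTdef
  have hTsa : IsSelfAdjoint T := by
    refine hL.add ?_
    have h1 : IsSelfAdjoint (rankOne ℂ γ γ) := (isPositive_rankOne_self γ).isSelfAdjoint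
    exact IsSelfAdjoint.smul (by simp [IsSelfAdjoint]) h1
  have hT0 : 0 ≤ T := by
    rw [ContinuousLinearMap.nonneg_iff_isPositive]
    refine ⟨ContinuousLinearMap.isSelfAdjoint_iff_isSymmetric.1 hTsa, fun v => ?_⟩
    rw [ContinuousLinearMap.reApplyInnerSelf_apply, ← inner_re_symm]
    have : (inner ℂ v (T v)).re = (inner ℂ v (L v)).re + k * ‖inner ℂ γ v‖ ^ 2 := by
      rw [hTdef, add_apply, inner_add_right, Complex.add_re, smul_apply, hinner]
    exact (hT v).trans_eq this.symm
  have hunit : IsUnit (algebraMap ℝ (H →L[ℂ] H) μ - T) := by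
    by_contra h
    exact absurd (spectrum_nonneg_of_nonneg hT0 (spectrum.mem_iff.2 h)) (not_le.2 hμ0)
  obtain ⟨S, hS⟩ := hunit.neg
  have hμv : ∀ v, algebraMap ℝ (H →L[ℂ] H) μ v = (μ : ℂ) • v := fun v => rfl
  have hSv : ∀ v, (S : H →L[ℂ] H) v = L v + (k * inner ℂ γ v : ℂ) • γ - (μ : ℂ) • v := fun v => by
    rw [hS, neg_sub, hTdef, sub_apply, add_apply, smul_apply, rankOne_apply, hμv, smul_smul]
  set e := (↑S⁻¹ : H →L[ℂ] H) γ with he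
  have hSe : (S : H →L[ℂ] H) e = γ := by
    rw [he, ← mul_apply_eq_comp, Units.mul_inv, one_apply_eq_self]
  by_cases hδ : (k : ℂ) * inner ℂ γ e = 1
  · refine ⟨e, fun h0 => ?_, ?_⟩
    · rw [h0, inner_zero_right, mul_zero] at hδ
      exact zero_ne_one hδ
    · have := hSv e
      rw [hSe, hδ, one_smul] at this
      rw [← sub_eq_zero]
      have h2 : L e - (μ : ℂ) • e = (L e + γ - (μ : ℂ) • e) - γ := by abel
      rw [h2, ← this, sub_self]
  · exfalso
    have hδ' : 1 - (k : ℂ) * inner ℂ γ e ≠ 0 := sub_ne_zero.2 (Ne.symm hδ)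
    set δ := 1 - (k : ℂ) * inner ℂ γ e with hδdef
    set Q : H →L[ℂ] H := rankOne ℂ e γ with hQ
    have hQQ : Q * Q = (inner ℂ γ e : ℂ) • Q := by
      ext v
      simp only [hQ, mul_apply_eq_comp, rankOne_apply, smul_apply, inner_smul_right,
        smul_smul]
      rw [mul_comm]
    have hcoef : k / δ - k - k * (k / δ) * inner ℂ γ e = 0 := by
      field_simp
      rw [hδdef]
      ring
    have h1 : (1 - (k : ℂ) • Q) * (1 + (k / δ : ℂ) • Q) = 1 := by
      have : (1 - (k : ℂ) • Q) * (1 + (k / δ : ℂ) • Q) =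
          1 + (k / δ - k - k * (k / δ) * inner ℂ γ e : ℂ) • Q := by
        rw [sub_mul, one_mul, mul_add, mul_one, smul_mul_smul_comm, hQQ]
        module
      rw [this, hcoef, zero_smul, add_zero]
    have h2 : (1 + (k / δ : ℂ) • Q) * (1 - (k : ℂ) • Q) = 1 := by
      have : (1 + (k / δ : ℂ) • Q) * (1 - (k : ℂ) • Q) =
          1 + (k / δ - k - k * (k / δ) * inner ℂ γ e : ℂ) • Q := by
        rw [add_mul, one_mul, mul_sub, mul_one, smul_mul_smul_comm, hQQ]
        module
      rw [this, hcoef, zero_smul, add_zero]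
    have h3 : IsUnit (1 - (k : ℂ) • Q) := ⟨⟨_, _, h1, h2⟩, rfl⟩
    refine spectrum.mem_iff.1 hμ ?_
    have h4 : algebraMap ℝ (H →L[ℂ] H) μ - L = -((S : H →L[ℂ] H) * (1 - (k : ℂ) • Q)) := by
      ext v
      have h5 : (1 - (k : ℂ) • Q) v = v - (k * inner ℂ γ v : ℂ) • e := by
        rw [sub_apply, one_apply_eq_self, smul_apply, hQ, rankOne_apply, smul_smul]
      rw [neg_apply, mul_apply_eq_comp, h5, map_sub, map_smul, hSe, hSv, sub_apply, hμv]
      abel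
    rw [h4]
    exact (S.isUnit.mul h3).neg

variable {L : H →L[ℂ] H} {γ : H} {k : ℝ}

theorem eq_zero_of_neg_eigenvector
    (hT : ∀ v, 0 ≤ (inner ℂ v (L v)).re + k * ‖inner ℂ γ v‖ ^ 2) {v : H} {ν : ℝ} (hν : ν < 0)
    (hv : L v = (ν : ℂ) • v) (hγ : inner ℂ γ v = 0) : v = 0 := by
  have h := hT v
  rw [hv, re_inner_smul_self, hγ, norm_zero, zero_pow two_ne_zero, mul_zero, add_zero] at h
  have h1 : ‖v‖ ^ 2 ≤ 0 := nonpos_of_mul_nonneg_right h hν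
  simpa using le_antisymm h1 (sq_nonneg _)

/-- Two eigenvectors for distinct nonpositive eigenvalues, the first one negative, have a
combination orthogonal to `γ` on which the quadratic form of `L` is negative, unless the second one
is itself orthogonal to `γ`. -/
theorem inner_eq_zero_of_nonpos_eigenvector (hL : (L : H →ₗ[ℂ] H).IsSymmetric)
    (hT : ∀ v, 0 ≤ (inner ℂ v (L v)).re + k * ‖inner ℂ γ v‖ ^ 2) {e v : H} {ν η : ℝ} (hν : ν < 0)
    (hη : η ≤ 0) (hne : η ≠ ν) (he0 : e ≠ 0) (he : L e = (ν : ℂ) • e) (hv : L v = (η : ℂ) • v) :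
    inner ℂ γ v = 0 := by
  have hev : inner ℂ e v = 0 := by
    have h := hL e v
    simp only [ContinuousLinearMap.coe_coe, he, hv, inner_smul_left, inner_smul_right,
      Complex.conj_ofReal] at h
    have h2 : ((ν : ℂ) - η) * inner ℂ e v = 0 := by rw [sub_mul, h, sub_self]
    refine (mul_eq_zero.1 h2).resolve_left (sub_ne_zero.2 ?_)
    exact_mod_cast hne.symm
  have hve : inner ℂ v e = 0 := inner_eq_zero_symm.1 hev
  set a : ℂ := inner ℂ γ e
  set d : ℂ := inner ℂ γ v
  have hu := hT (a • v - d • e)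
  have h0 : inner ℂ γ (a • v - d • e) = 0 := by
    rw [inner_sub_right, inner_smul_right, inner_smul_right, mul_comm, sub_self]
  have h1 : (inner ℂ (a • v - d • e) (L (a • v - d • e))).re =
      ‖a‖ ^ 2 * (η * ‖v‖ ^ 2) + ‖d‖ ^ 2 * (ν * ‖e‖ ^ 2) := by
    rw [map_sub, map_smul, map_smul, he, hv, ← re_inner_smul_self v η, ← re_inner_smul_self e ν]
    simp only [inner_sub_left, inner_sub_right, inner_smul_left, inner_smul_right, hev, hve,
      mul_zero, sub_zero, zero_sub]
    rw [← Complex.normSq_eq_norm_sq, ← Complex.normSq_eq_norm_sq, ← Complex.re_ofReal_mul,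
      ← Complex.re_ofReal_mul, ← Complex.add_re, Complex.normSq_eq_conj_mul_self,
      Complex.normSq_eq_conj_mul_self]
    congr 1
    ring
  rw [h0, h1, norm_zero, zero_pow two_ne_zero, mul_zero, add_zero] at hu
  have h2 : 0 < ‖e‖ ^ 2 := by positivity
  have h3 : ‖a‖ ^ 2 * (η * ‖v‖ ^ 2) ≤ 0 :=
    mul_nonpos_of_nonneg_of_nonpos (sq_nonneg _)
      (mul_nonpos_of_nonpos_of_nonneg hη (sq_nonneg _))
  by_contra hd
  have h4 : 0 < ‖d‖ ^ 2 := by positivity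
  nlinarith [mul_pos h4 (mul_pos (neg_pos.2 hν) h2)]

/-- An operator that is nonnegative up to a rank one form has at most one negative eigenvalue. -/
theorem neg_eigenvalue_unique (hL : (L : H →ₗ[ℂ] H).IsSymmetric)
    (hT : ∀ v, 0 ≤ (inner ℂ v (L v)).re + k * ‖inner ℂ γ v‖ ^ 2) {e v : H} {ν η : ℝ} (hν : ν < 0)
    (hη : η < 0) (he0 : e ≠ 0) (hv0 : v ≠ 0) (he : L e = (ν : ℂ) • e) (hv : L v = (η : ℂ) • v) :
    η = ν := by
  by_contra hne
  exact hv0 (eq_zero_of_neg_eigenvector hT hη hv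
    (inner_eq_zero_of_nonpos_eigenvector hL hT hν hη.le hne he0 he hv))

/-- A negative eigenvalue of an operator that is nonnegative up to a rank one form is simple. -/
theorem finrank_eigenspace_neg
    (hT : ∀ v, 0 ≤ (inner ℂ v (L v)).re + k * ‖inner ℂ γ v‖ ^ 2) {e : H} {ν : ℝ} (hν : ν < 0)
    (he0 : e ≠ 0) (he : L e = (ν : ℂ) • e) :
    Module.finrank ℂ (Module.End.eigenspace (L : H →ₗ[ℂ] H) (ν : ℂ)) = 1 := by
  have hγ : inner ℂ γ e ≠ 0 := fun h => he0 (eq_zero_of_neg_eigenvector hT hν he h)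
  have hspan : Module.End.eigenspace (L : H →ₗ[ℂ] H) (ν : ℂ) = Submodule.span ℂ {e} := by
    ext v
    rw [Module.End.mem_eigenspace_iff, ContinuousLinearMap.coe_coe, Submodule.mem_span_singleton]
    constructor
    · intro hv
      refine ⟨inner ℂ γ v / inner ℂ γ e, ?_⟩
      rw [eq_comm, ← sub_eq_zero]
      refine eq_zero_of_neg_eigenvector hT hν ?_ ?_
      · rw [map_sub, map_smul, he, hv, smul_sub, smul_comm]
      · rw [inner_sub_right, inner_smul_right, div_mul_cancel₀ _ hγ, sub_self]
    · rintro ⟨a, rfl⟩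
      rw [map_smul, he, smul_comm]
  rw [hspan, finrank_span_singleton he0]

end RankOne

/-! ### The quadratic form of the linearised operator -/

/-- The Green function as a vector of `L²(ℝ)`; pairing with it evaluates `G ∗ v` at the origin. -/
noncomputable def greenVec : L2 := (memLp_greenFun 0).toLp _

theorem inner_greenVec (v : L2) : inner ℂ greenVec v = greenConv v 0 := by
  rw [L2.inner_def]
  refine integral_congr_ae ?_
  filter_upwards [(memLp_greenFun 0).coeFn_toLp] with x hx
  rw [RCLike.inner_apply, greenVec, hx, Complex.conj_ofReal, mul_comm]

theorem integrable_norm_sq (v : L2) : Integrable fun x => ‖v x‖ ^ 2 :=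
  (memLp_two_iff_integrable_sq_norm (Lp.memLp v).1).1 (Lp.memLp v)

theorem norm_sq_eq_integral (v : L2) : ‖v‖ ^ 2 = ∫ x, ‖v x‖ ^ 2 := by
  have h : (inner ℂ v v : ℂ) = ((∫ x, ‖v x‖ ^ 2 : ℝ) : ℂ) := by
    rw [L2.inner_def, ← integral_complex_ofReal]
    refine integral_congr_ae (.of_forall fun x => ?_)
    simp [inner_self_eq_norm_sq_to_K]
  rw [inner_self_eq_norm_sq_to_K, ← RCLike.ofReal_pow] at h
  exact Complex.ofReal_injective h

theorem norm_helmholtzInv_le : ‖helmholtzInv‖ ≤ 1 :=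
  LinearMap.mkContinuous_norm_le _ zero_le_one _

namespace IsSolitaryWave

variable {c : ℝ} {φ : ℝ → ℝ}

theorem integrable_symbol_mul (hφ : IsSolitaryWave c φ) (v : L2) :
    Integrable fun x => (c - φ x) * ‖v x‖ ^ 2 := by
  obtain ⟨B, hB0, hB⟩ := hφ.exists_bound
  have hc := hφ.continuous
  have hv := integrable_norm_sq v
  refine (hv.const_mul (|c| + B)).mono'
    ((Continuous.aestronglyMeasurable (by fun_prop)).mul hv.1) (.of_forall fun x => ?_)
  rw [norm_mul, Real.norm_of_nonneg (sq_nonneg ‖v x‖)]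
  exact mul_le_mul_of_nonneg_right ((abs_sub _ _).trans (by linarith [hB x])) (sq_nonneg _)

theorem re_inner_linearizedOp (hφ : IsSolitaryWave c φ) (v : L2) :
    (inner ℂ v (linearizedOp hφ v)).re =
      (∫ x, (c - φ x) * ‖v x‖ ^ 2) - (inner ℂ v (helmholtzInv v)).re := by
  rw [linearizedOp, sub_apply, inner_sub_right, Complex.sub_re, inner_mulOp]
  congr 1
  rw [← Complex.ofReal_re (∫ x, (c - φ x) * ‖v x‖ ^ 2), ← integral_complex_ofReal]
  congr 2
  funext x
  rw [mul_assoc, Complex.mul_conj, Complex.normSq_eq_norm_sq]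
  push_cast
  ring

theorem ae_abs_deriv_pos (hc₁ : 1 < c) (hc₂ : c < 4 / 3) (hφ : IsSolitaryWave c φ) :
    ∀ᵐ x, 0 < |deriv φ x| :=
  (Measure.ae_ne volume 0).mono fun _ hx => abs_pos.2 (hφ.deriv_ne_zero hc₁ hc₂ hx)

theorem integrable_dirichletGreen_mul_deriv (hc₁ : 1 < c) (hc₂ : c < 4 / 3)
    (hφ : IsSolitaryWave c φ) (x : ℝ) :
    Integrable (fun y => dirichletGreen x y * deriv φ y) ∧
      ∫ y, dirichletGreen x y * deriv φ y = (c - φ x) * deriv φ x := by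
  have h1 := integrable_greenFun_mul_real (hφ.memLp_deriv hc₁ hc₂) x
  have h2 := (integrable_greenFun_mul_real (hφ.memLp_deriv hc₁ hc₂) 0).const_mul (2 * greenFun x)
  have heq : (fun y => dirichletGreen x y * deriv φ y) = fun y =>
      greenFun (x - y) * deriv φ y - 2 * greenFun x * (greenFun (0 - y) * deriv φ y) := by
    funext y
    rw [dirichletGreen, zero_sub, greenFun_neg]
    ring
  rw [heq]
  refine ⟨h1.sub h2, ?_⟩
  rw [integral_sub h1 h2, integral_const_mul, hφ.greenConv_deriv hc₁ hc₂,
    hφ.greenConv_deriv hc₁ hc₂, hφ.deriv_zero]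
  ring

/-- As `φ'` has a constant sign on each half-line and the Dirichlet Green function decouples the
half-lines, `φ'` may be replaced by `|φ'|`. -/
theorem integrable_dirichletGreen_mul_abs_deriv (hc₁ : 1 < c) (hc₂ : c < 4 / 3)
    (hφ : IsSolitaryWave c φ) (x : ℝ) :
    Integrable (fun y => dirichletGreen x y * |deriv φ y|) ∧
      ∫ y, dirichletGreen x y * |deriv φ y| = (c - φ x) * |deriv φ x| := by
  obtain ⟨h1, h2⟩ := hφ.integrable_dirichletGreen_mul_deriv hc₁ hc₂ x
  rcases le_or_gt 0 x with hx | hx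
  · have heq : (fun y => dirichletGreen x y * |deriv φ y|) =
        fun y => -(dirichletGreen x y * deriv φ y) := by
      funext y
      rcases le_or_gt y 0 with hy | hy
      · simp [dirichletGreen_eq_zero (mul_nonpos_of_nonneg_of_nonpos hx hy)]
      · rw [abs_of_neg (hφ.deriv_neg hc₁ hc₂ hy), mul_neg]
    have habs : |deriv φ x| = -deriv φ x := by
      rcases hx.eq_or_lt with rfl | hx
      · simp [hφ.deriv_zero]
      · exact abs_of_neg (hφ.deriv_neg hc₁ hc₂ hx)
    rw [heq, integral_neg, h2, habs, mul_neg]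
    exact ⟨h1.neg, rfl⟩
  · have heq : (fun y => dirichletGreen x y * |deriv φ y|) =
        fun y => dirichletGreen x y * deriv φ y := by
      funext y
      rcases le_or_gt 0 y with hy | hy
      · simp [dirichletGreen_eq_zero (mul_nonpos_of_nonpos_of_nonneg hx.le hy)]
      · rw [abs_of_pos (hφ.deriv_pos hc₁ hc₂ hy)]
    rw [heq, h2, abs_of_pos (hφ.deriv_pos hc₁ hc₂ hx)]
    exact ⟨h1, rfl⟩

/-- The ground state representation of the quadratic form of the linearised operator, with ground
state `|φ'|`. -/
theorem quadraticForm_representation (hc₁ : 1 < c) (hc₂ : c < 4 / 3) (hφ : IsSolitaryWave c φ)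
    (v : L2) :
    Integrable (fun z : ℝ × ℝ => dirichletGreen z.1 z.2 * (|deriv φ z.1| * |deriv φ z.2|) *
        ‖v z.1 / |deriv φ z.1| - v z.2 / |deriv φ z.2|‖ ^ 2) (volume.prod volume) ∧
      ∫ z : ℝ × ℝ, dirichletGreen z.1 z.2 * (|deriv φ z.1| * |deriv φ z.2|) *
        ‖v z.1 / |deriv φ z.1| - v z.2 / |deriv φ z.2|‖ ^ 2 ∂(volume.prod volume) =
      2 * (inner ℂ v (linearizedOp hφ v)).re + 4 * ‖inner ℂ greenVec v‖ ^ 2 := by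
  have h := groundState_representation (b := fun x => c - φ x) (p := fun x => |deriv φ x|) (v := v)
    hφ.continuous_deriv.abs.measurable (hφ.ae_abs_deriv_pos hc₁ hc₂)
    (fun x => (hφ.integrable_dirichletGreen_mul_abs_deriv hc₁ hc₂ x).1)
    (fun x => (hφ.integrable_dirichletGreen_mul_abs_deriv hc₁ hc₂ x).2)
    (Lp.memLp v) (hφ.integrable_symbol_mul v)
  rwa [← inner_helmholtzInv, ← hφ.re_inner_linearizedOp, ← inner_greenVec] at h

theorem quadraticForm_add_nonneg (hc₁ : 1 < c) (hc₂ : c < 4 / 3) (hφ : IsSolitaryWave c φ)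
    (v : L2) :
    0 ≤ (inner ℂ v (linearizedOp hφ v)).re + 2 * ‖inner ℂ greenVec v‖ ^ 2 := by
  have h := (hφ.quadraticForm_representation hc₁ hc₂ v).2
  have h0 := integral_nonneg (μ := volume.prod volume)
    (f := fun z : ℝ × ℝ => dirichletGreen z.1 z.2 * (|deriv φ z.1| * |deriv φ z.2|) *
        ‖v z.1 / |deriv φ z.1| - v z.2 / |deriv φ z.2|‖ ^ 2)
    fun z => mul_nonneg (mul_nonneg (dirichletGreen_nonneg _ _) (by positivity)) (by positivity)
  rw [h] at h0
  linarith

/-! ### The vectors `φ'` and `|φ'|` -/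

theorem memLp_abs_deriv (hc₁ : 1 < c) (hc₂ : c < 4 / 3) (hφ : IsSolitaryWave c φ) :
    MemLp (fun x => ((|deriv φ x| : ℝ) : ℂ)) 2 volume := by
  have hc := hφ.continuous_deriv
  refine (hφ.memLp_deriv hc₁ hc₂).of_le (Continuous.aestronglyMeasurable (by fun_prop))
    (.of_forall fun x => ?_)
  simp

theorem inner_greenVec_abs_deriv_ne_zero (hc₁ : 1 < c) (hc₂ : c < 4 / 3)
    (hφ : IsSolitaryWave c φ) :
    inner ℂ greenVec ((hφ.memLp_abs_deriv hc₁ hc₂).toLp _) ≠ 0 := by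
  rw [inner_greenVec, greenConv_congr (hφ.memLp_abs_deriv hc₁ hc₂).coeFn_toLp, greenConv_ofReal]
  intro h
  have h0 : ∀ y, 0 ≤ greenFun (0 - y) * |deriv φ y| := fun y =>
    mul_nonneg (greenFun_nonneg _) (abs_nonneg _)
  have h1 := (integral_eq_zero_iff_of_nonneg h0
    (integrable_greenFun_mul_real (hφ.memLp_abs_deriv hc₁ hc₂) 0)).1 (Complex.ofReal_eq_zero.1 h)
  obtain ⟨y, hy, hy'⟩ := (h1.and (hφ.ae_abs_deriv_pos hc₁ hc₂)).exists
  exact (mul_pos (greenFun_pos (0 - y)) hy').ne' hy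

/-- The ground state `|φ'|` is a negative direction, as the integral in the ground state
representation vanishes for it. -/
theorem re_inner_abs_deriv_neg (hc₁ : 1 < c) (hc₂ : c < 4 / 3) (hφ : IsSolitaryWave c φ) :
    (inner ℂ ((hφ.memLp_abs_deriv hc₁ hc₂).toLp _)
      (linearizedOp hφ ((hφ.memLp_abs_deriv hc₁ hc₂).toLp _))).re < 0 := by
  set P : L2 := (hφ.memLp_abs_deriv hc₁ hc₂).toLp _ with hP
  have h := (hφ.quadraticForm_representation hc₁ hc₂ P).2
  have hone : ∀ᵐ x, P x / |deriv φ x| = 1 := by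
    filter_upwards [(hφ.memLp_abs_deriv hc₁ hc₂).coeFn_toLp, hφ.ae_abs_deriv_pos hc₁ hc₂]
      with x hx hx'
    rw [hP, hx]
    exact div_self (Complex.ofReal_ne_zero.2 hx'.ne')
  rw [integral_eq_zero_of_ae] at h
  · have h1 : 0 < ‖(inner ℂ greenVec P : ℂ)‖ :=
      norm_pos_iff.2 (hφ.inner_greenVec_abs_deriv_ne_zero hc₁ hc₂)
    nlinarith
  · filter_upwards [Measure.quasiMeasurePreserving_fst.ae hone,
      Measure.quasiMeasurePreserving_snd.ae hone] with z h1 h2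
    rw [h1, h2]
    simp

theorem linearizedOp_deriv (hc₁ : 1 < c) (hc₂ : c < 4 / 3) (hφ : IsSolitaryWave c φ) :
    linearizedOp hφ ((hφ.memLp_deriv hc₁ hc₂).toLp _) = 0 := by
  refine Lp.ext ?_
  have hd := (hφ.memLp_deriv hc₁ hc₂).coeFn_toLp
  filter_upwards [coeFn_linearizedOp hφ ((hφ.memLp_deriv hc₁ hc₂).toLp _), hd,
    Lp.coeFn_zero ℂ 2 (volume : Measure ℝ)] with x h1 h2 h3
  rw [h1, h3, h2, Pi.zero_apply]
  change _ - greenConv _ x = 0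
  rw [greenConv_congr hd, greenConv_ofReal, hφ.greenConv_deriv hc₁ hc₂]
  push_cast
  ring

theorem inner_greenVec_deriv (hc₁ : 1 < c) (hc₂ : c < 4 / 3) (hφ : IsSolitaryWave c φ) :
    inner ℂ greenVec ((hφ.memLp_deriv hc₁ hc₂).toLp _) = 0 := by
  rw [inner_greenVec, greenConv_congr (hφ.memLp_deriv hc₁ hc₂).coeFn_toLp, greenConv_ofReal,
    hφ.greenConv_deriv hc₁ hc₂, hφ.deriv_zero, mul_zero, Complex.ofReal_zero]

theorem toLp_deriv_ne_zero (hc₁ : 1 < c) (hc₂ : c < 4 / 3) (hφ : IsSolitaryWave c φ) :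
    (hφ.memLp_deriv hc₁ hc₂).toLp _ ≠ 0 := by
  intro h
  have h1 := (hφ.memLp_deriv hc₁ hc₂).coeFn_toLp
  rw [h] at h1
  obtain ⟨x, hx, hx', hx''⟩ := (h1.and ((Lp.coeFn_zero ℂ 2 (volume : Measure ℝ)).and
    (hφ.ae_abs_deriv_pos hc₁ hc₂))).exists
  rw [hx'] at hx
  exact (abs_pos.1 hx'') (Complex.ofReal_eq_zero.1 hx.symm)

/-! ### The kernel -/

/-- On a half-line, a null vector of the nonnegative form is a multiple of the ground state. -/
theorem exists_eq_mul_abs_deriv (hc₁ : 1 < c) (hc₂ : c < 4 / 3) (hφ : IsSolitaryWave c φ) {v : L2}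
    (hv : (inner ℂ v (linearizedOp hφ v)).re = 0) (hγ : inner ℂ greenVec v = 0) {s : Set ℝ}
    (hs : volume s ≠ 0) (hpos : ∀ x ∈ s, ∀ y ∈ s, 0 < x * y) :
    ∃ k : ℂ, ∀ᵐ y, y ∈ s → v y = k * |deriv φ y| := by
  obtain ⟨hi, h⟩ := hφ.quadraticForm_representation hc₁ hc₂ v
  rw [hv, hγ, norm_zero, zero_pow two_ne_zero, mul_zero, mul_zero, add_zero] at h
  have h0 := (integral_eq_zero_iff_of_nonneg (fun z =>
    mul_nonneg (mul_nonneg (dirichletGreen_nonneg _ _) (by positivity)) (by positivity)) hi).1 h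
  have h1 := (Measure.ae_ae_of_ae_prod h0).and (hφ.ae_abs_deriv_pos hc₁ hc₂)
  obtain ⟨x, hx, hrow, hpx⟩ : ∃ x, x ∈ s ∧ _ :=
    ((frequently_ae_mem_iff.2 hs).and_eventually h1).exists
  refine ⟨v x / |deriv φ x|, ?_⟩
  filter_upwards [hrow, hφ.ae_abs_deriv_pos hc₁ hc₂] with y hy hpy hys
  have hD := dirichletGreen_pos (hpos x hx y hys)
  simp only [Pi.zero_apply, mul_eq_zero, hD.ne', hpx.ne', hpy.ne', false_or, ne_eq,
    OfNat.ofNat_ne_zero, not_false_eq_true, pow_eq_zero_iff, norm_eq_zero, sub_eq_zero] at hy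
  rw [hy, div_mul_cancel₀ _ (Complex.ofReal_ne_zero.2 hpy.ne')]

/-- A null vector orthogonal to `greenVec` combines `φ'` and `|φ'|`, and the coefficient of `|φ'|`
vanishes by orthogonality. -/
theorem mem_span_deriv (hc₁ : 1 < c) (hc₂ : c < 4 / 3) (hφ : IsSolitaryWave c φ) {v : L2}
    (hv : (inner ℂ v (linearizedOp hφ v)).re = 0) (hγ : inner ℂ greenVec v = 0) :
    v ∈ Submodule.span ℂ {(hφ.memLp_deriv hc₁ hc₂).toLp _} := by
  obtain ⟨k, hk⟩ := hφ.exists_eq_mul_abs_deriv hc₁ hc₂ hv hγ (s := Set.Ioi 0)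
    (by simp) fun x hx y hy => mul_pos hx hy
  obtain ⟨l, hl⟩ := hφ.exists_eq_mul_abs_deriv hc₁ hc₂ hv hγ (s := Set.Iio 0)
    (by simp) fun x hx y hy => mul_pos_of_neg_of_neg hx hy
  have hsum : v = ((l - k) / 2) • (hφ.memLp_deriv hc₁ hc₂).toLp _ +
      ((l + k) / 2) • (hφ.memLp_abs_deriv hc₁ hc₂).toLp _ := by
    refine Lp.ext ?_
    filter_upwards [Lp.coeFn_add (((l - k) / 2) • (hφ.memLp_deriv hc₁ hc₂).toLp _)
        (((l + k) / 2) • (hφ.memLp_abs_deriv hc₁ hc₂).toLp _),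
      Lp.coeFn_smul ((l - k) / 2) ((hφ.memLp_deriv hc₁ hc₂).toLp _),
      Lp.coeFn_smul ((l + k) / 2) ((hφ.memLp_abs_deriv hc₁ hc₂).toLp _),
      (hφ.memLp_deriv hc₁ hc₂).coeFn_toLp, (hφ.memLp_abs_deriv hc₁ hc₂).coeFn_toLp,
      Measure.ae_ne volume 0, hk, hl] with x h1 h2 h3 h4 h5 hx hkx hlx
    rw [h1, Pi.add_apply, h2, h3, Pi.smul_apply, Pi.smul_apply, h4, h5, smul_eq_mul, smul_eq_mul]
    rcases lt_or_gt_of_ne hx with hx | hx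
    · rw [hlx hx, abs_of_pos (hφ.deriv_pos hc₁ hc₂ hx)]
      ring
    · rw [hkx hx, abs_of_neg (hφ.deriv_neg hc₁ hc₂ hx)]
      push_cast
      ring
  have h0 := hγ
  rw [hsum, inner_add_right, inner_smul_right, inner_smul_right, hφ.inner_greenVec_deriv hc₁ hc₂,
    mul_zero, zero_add] at h0
  have h1 := (mul_eq_zero.1 h0).resolve_right (hφ.inner_greenVec_abs_deriv_ne_zero hc₁ hc₂)
  rw [h1, zero_smul, add_zero] at hsum
  rw [hsum]
  exact Submodule.smul_mem _ _ (Submodule.mem_span_singleton_self _)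

/-! ### The lower bound for eigenvalues -/

/-- Since `‖G ∗ ·‖ ≤ 1`, an eigenvalue `μ ≤ λ₀` would give `∫ (φ_max - φ) |e|² ≤ 0`. -/
theorem lambdaZero_lt_of_eigenvector (hc₁ : 1 < c) (hc₂ : c < 4 / 3) (hφ : IsSolitaryWave c φ)
    {e : L2} (he0 : e ≠ 0) {μ : ℝ} (he : linearizedOp hφ e = (μ : ℂ) • e) : lambdaZero c < μ := by
  by_contra! hμ
  have hsymb := hφ.integrable_symbol_mul e
  have hnorm := integrable_norm_sq e
  have hle : (inner ℂ e (helmholtzInv e)).re ≤ ‖e‖ ^ 2 := by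
    refine (Complex.re_le_norm _).trans ((norm_inner_le_norm _ _).trans ?_)
    rw [sq]
    exact mul_le_mul_of_nonneg_left
      ((helmholtzInv.le_of_opNorm_le norm_helmholtzInv_le e).trans_eq (one_mul _)) (norm_nonneg _)
  have h1 := hφ.re_inner_linearizedOp e
  rw [he, re_inner_smul_self] at h1
  have h2 : ∫ x, ((c - φ x) * ‖e x‖ ^ 2 - (1 + μ) * ‖e x‖ ^ 2) ≤ 0 := by
    rw [integral_sub hsymb (hnorm.const_mul _), integral_const_mul, ← norm_sq_eq_integral]
    linarith
  have hgap : ∀ x, phiMax c - φ x ≤ c - φ x - (1 + μ) := fun x => by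
    unfold lambdaZero at hμ
    linarith
  have h3 : ∀ x, 0 ≤ (c - φ x) * ‖e x‖ ^ 2 - (1 + μ) * ‖e x‖ ^ 2 := fun x => by
    rw [← sub_mul]
    exact mul_nonneg ((sub_nonneg.2 (hφ.le_phiMax hc₁ hc₂ x)).trans (hgap x)) (sq_nonneg _)
  have h4 := (integral_eq_zero_iff_of_nonneg h3 (hsymb.sub (hnorm.const_mul _))).1
    (le_antisymm h2 (integral_nonneg h3))
  refine he0 ((Lp.eq_zero_iff_ae_eq_zero).2 ?_)
  filter_upwards [h4, Measure.ae_ne volume 0] with x hx hx0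
  rw [Pi.zero_apply, ← sub_mul] at hx
  have h5 : 0 < c - φ x - (1 + μ) :=
    (sub_pos.2 (hφ.lt_phiMax hc₁ hc₂ hx0)).trans_le (hgap x)
  simpa [h5.ne'] using hx

end IsSolitaryWave

theorem lemma4p3 (c : ℝ) (hc₁ : 1 < c) (hc₂ : c < 4 / 3) (φ₀ : ℝ → ℝ)
    (hφ₀ : IsSolitaryWave c φ₀) :
    IsSelfAdjoint (linearizedOp hφ₀) ∧
    (∀ z ∈ spectrum ℂ (linearizedOp hφ₀), z.im = 0) ∧
    (∃ hd : MemLp (fun x => ((deriv φ₀ x : ℝ) : ℂ)) 2 volume,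
      LinearMap.ker (linearizedOp hφ₀ : L2 →ₗ[ℂ] L2) =
        Submodule.span ℂ {hd.toLp (fun x => ((deriv φ₀ x : ℝ) : ℂ))} ∧
      Module.finrank ℂ (LinearMap.ker (linearizedOp hφ₀ : L2 →ₗ[ℂ] L2)) = 1) ∧
    (∃ μ : ℝ, lambdaZero c < μ ∧ μ < 0 ∧
      Module.End.HasEigenvalue (linearizedOp hφ₀ : L2 →ₗ[ℂ] L2) (μ : ℂ) ∧
      Module.finrank ℂ
        (Module.End.eigenspace (linearizedOp hφ₀ : L2 →ₗ[ℂ] L2) (μ : ℂ)) = 1 ∧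
      ∀ ν : ℝ, ν < 0 →
        Module.End.HasEigenvalue (linearizedOp hφ₀ : L2 →ₗ[ℂ] L2) (ν : ℂ) → ν = μ) := by
  have hsa := isSelfAdjoint_linearizedOp hφ₀
  have hsymm := ContinuousLinearMap.isSelfAdjoint_iff_isSymmetric.1 hsa
  have hT := hφ₀.quadraticForm_add_nonneg hc₁ hc₂
  obtain ⟨μ, hμ, e, he0, he⟩ := exists_neg_eigenvalue hsa hT (hφ₀.re_inner_abs_deriv_neg hc₁ hc₂)
  have hker : LinearMap.ker (linearizedOp hφ₀ : L2 →ₗ[ℂ] L2) =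
      Submodule.span ℂ {(hφ₀.memLp_deriv hc₁ hc₂).toLp _} := by
    refine le_antisymm (fun v hv => ?_) ?_
    · have hv0 : linearizedOp hφ₀ v = 0 := hv
      refine hφ₀.mem_span_deriv hc₁ hc₂ (by rw [hv0, inner_zero_right, Complex.zero_re]) ?_
      exact inner_eq_zero_of_nonpos_eigenvector hsymm hT hμ le_rfl hμ.ne' he0 he (by simp [hv0])
    · rw [Submodule.span_singleton_le_iff_mem]
      exact hφ₀.linearizedOp_deriv hc₁ hc₂
  refine ⟨hsa, fun z hz => ?_, ⟨hφ₀.memLp_deriv hc₁ hc₂, hker, ?_⟩, μ,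
    hφ₀.lambdaZero_lt_of_eigenvector hc₁ hc₂ he0 he, hμ,
    hasEigenvalue_iff_exists_apply_eq_smul.2 ⟨e, he0, he⟩, finrank_eigenspace_neg hT hμ he0 he,
    fun ν hν h => ?_⟩
  · rw [hsa.mem_spectrum_eq_re hz, Complex.ofReal_im]
  · rw [hker, finrank_span_singleton (hφ₀.toLp_deriv_ne_zero hc₁ hc₂)]
  · obtain ⟨v, hv0, hv⟩ := hasEigenvalue_iff_exists_apply_eq_smul.1 h
    exact neg_eigenvalue_unique hsymm hT hμ hν he0 hv0 he hv
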